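/- Let $\xi\in(0,1)$ and let $n\colon(0,1)\to\mathbb R$ be $C^\infty$ on $(0,\xi)$ and on $(\xi,1)$, bounded above and below by positive constants, and such that the one-sided limits $n_1(\xi)=n(\xi^-)$, $n_2(\xi)=n(\xi^+)$, $n_2(1)=n(1^-)$ exist. For $m\in\mathbb Z$ let $H_m=H_m^{(1)}$ be the Hankel function of the first kind (principal branch), and for $\kappa$ with $H_m(\kappa)\ne0$ put $\beta_m(\kappa)=\kappa H_m'(\kappa)/H_m(\kappa)$. Let $\Omega$ be the open unit disc in $\mathbb R^2$ and $T_\kappa\colon\sum_m\varphi_m e^{im\theta}\mapsto\sum_m\beta_m(\kappa)\varphi_m e^{im\theta}$ the Dirichlet-to-Neumann operator on $\partial\Omega$. A number $k\in\mathbb C\setminus\{0\}$ with $H_m(k n_2(1))\neq0$ for all $m\in\mathbb Z$ is a *resonance* if there is $u\in H^1(\Omega)\setminus\{0\}$ with $-\Delta u=(k\,n(|x|))^2u$ in $\Omega\setminus\{|x|=\xi\}$, with $u$ and $\partial_\nu u$ continuous across $|x|=\xi$, and with $\partial_\nu u=T_{k n_2(1)}u$ on $\partial\Omega$ (all in the weak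 sense). Fix $m\in\mathbb Z$, a resonance $k_\infty$ with $\operatorname{Im}k_\infty<0$, an open neighbourhood $\omega\subset\{\operatorname{Im}k<0\}$ of $k_\infty$, and analytic functions $k\mapsto h_{1,1,k}$ and $k\mapsto h_{2,2,k}$ on $\omega$ without zeros. Write $L_kv=-\frac1r(rv')'+\bigl(\frac{m^2}{r^2}-(k n)^2\bigr)v$. Assume that for every $k\in\omega$ one has $H_m(k n_2(1))\ne0$, and that each of the two problems $$L_kf_{1,1,k}=0\ \text{in }(0,\xi),\qquad f_{1,1,k}(0)=0\ (m\text{ odd})\ \text{ or }\ f_{1,1,k}'(0)=0\ (m\text{ even}),\qquad f_{1,1,k}'(\xi)-ik\,n_1(\xi)f_{1,1,k}(\xi)=h_{1,1,k},$$ $$L_kf_{2,2,k}=0\ \text{in }(\xi,1),\qquad -f_{2,2,k}'(\xi)-ik\,n_2(\xi)f_{2,2,k}(\xi)=h_{2,2,k},\qquad f_{2,2,k}'(1)-\beta_m(k n_2(1))f_{2,2,k}(1)=0$$ has a unique solution that is $C^2$ in the open interval and $C^1$ up to its end points. Put $$\det(k)=\det\begin{pmatrix}f_{1,1,k}(\xi)&-f_{2,2,k}(\xi)\\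 f_{1,1,k}'(\xi)&-f_{2,2,k}'(\xi)\end{pmatrix}.$$ Then $\det\colon\omega\to\mathbb C$ is analytic. If moreover $k_\infty$ is a simple root of $\det$, i.e. $\det(k_\infty)=0\ne\partial_k\det(k_\infty)$, then there are $\delta>0$ and $C\in\mathbb R$ with $B(k_\infty,\delta)\subset\omega$ such that for every $k_0\in B(k_\infty,\delta)$ the Newton sequence $$k_{l+1}=k_l-\frac{\det(k_l)}{\partial_k\det(k_l)}$$ is well defined (every $k_l$ lies in $B(k_\infty,\delta)$ and $\partial_k\det(k_l)\neq0$), converges to $k_\infty$, and converges quadratically: $|k_{l+1}-k_\infty|\le C|k_l-k_\infty|^2$ for all $l$. -/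

import Mathlib

open Set Filter Topology MeasureTheory
open scoped ContDiff

namespace RadialHelmholtz

noncomputable section

/-! ### Bessel and Hankel functions of integer order -/

/-- The Bessel function of the first kind `J_m`, `m ∈ ℕ`, by its everywhere convergent series
`J_m(z) = ∑_j (-1)^j / (j! (m+j)!) (z/2)^(2j+m)`. -/
def besselJ (m : ℕ) (z : ℂ) : ℂ :=
  ∑' j : ℕ, (-1 : ℂ) ^ j / ((j.factorial : ℂ) * ((m + j).factorial : ℂ)) * (z / 2) ^ (2 * j + m)

/-- The value `ψ(j + 1) = -γ + (1 + 1/2 + ... + 1/j)` of the digamma function at a positive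
integer. -/
def digammaSucc (j : ℕ) : ℝ := -Real.eulerMascheroniConstant + (harmonic j : ℝ)

/-- The Bessel function of the second kind `Y_m`, `m ∈ ℕ` (principal branch, cut along `(-∞, 0]`):
`π Y_m(z) = 2 log(z/2) J_m(z) - ∑_{j<m} (m-j-1)!/j! (z/2)^(2j-m)`
`  - ∑_j (ψ(j+1) + ψ(m+j+1)) (-1)^j / (j! (m+j)!) (z/2)^(2j+m)`. -/
def besselY (m : ℕ) (z : ℂ) : ℂ :=
  (1 / (Real.pi : ℂ)) *
    (2 * Complex.log (z / 2) * besselJ m z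
      - ∑ j ∈ Finset.range m,
          ((m - j - 1).factorial : ℂ) / (j.factorial : ℂ) * (z / 2) ^ (2 * (j : ℤ) - (m : ℤ))
      - ∑' j : ℕ, ((digammaSucc j + digammaSucc (m + j) : ℝ) : ℂ) *
          ((-1 : ℂ) ^ j / ((j.factorial : ℂ) * ((m + j).factorial : ℂ)) *
            (z / 2) ^ (2 * j + m)))

/-- The Hankel function of the first kind `H_m = H_m^{(1)} = J_m + i Y_m` of integer order
(principal branch, cut along `(-∞, 0]`), with `H_{-m} = (-1)^m H_m`. -/
def hankelH (m : ℤ) (z : ℂ) : ℂ :=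
  (if m < 0 then (-1 : ℂ) ^ m.natAbs else 1) *
    (besselJ m.natAbs z + Complex.I * besselY m.natAbs z)

/-- The Fourier symbol `κ H_m'(κ) / H_m(κ)` of the Dirichlet-to-Neumann operator `T_κ` on the unit
circle. -/
def dtnSymbol (m : ℤ) (κ : ℂ) : ℂ := κ * deriv (hankelH m) κ / hankelH m κ

/-! ### The refractive index -/

/-- `n` is an admissible refractive index on `(0,1)` with jump point `ξ`: it is smooth on `(0,ξ)`
and on `(ξ,1)`, bounded above and below by positive numbers, and `n₁ξ = n(ξ-)`, `n₂ξ = n(ξ+)`,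
`n₂one = n(1-)` are the boundary values of its two branches at `ξ` and `1`. -/
structure IsRefractiveIndex (ξ : ℝ) (n : ℝ → ℝ) (n₁ξ n₂ξ n₂one : ℝ) : Prop where
  jump_mem : ξ ∈ Ioo (0 : ℝ) 1
  smooth_left : ContDiffOn ℝ ∞ n (Ioo 0 ξ)
  smooth_right : ContDiffOn ℝ ∞ n (Ioo ξ 1)
  bounded : ∃ nmin nmax : ℝ, 0 < nmin ∧ ∀ r ∈ Ioo (0 : ℝ) 1, nmin ≤ n r ∧ n r ≤ nmax
  tendsto_left : Tendsto n (𝓝[<] ξ) (𝓝 n₁ξ)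
  tendsto_right : Tendsto n (𝓝[>] ξ) (𝓝 n₂ξ)
  tendsto_one : Tendsto n (𝓝[<] 1) (𝓝 n₂one)

/-! ### Resonances of the Helmholtz problem on the unit disc -/

/-- The Euclidean plane. -/
abbrev Plane : Type := EuclideanSpace ℝ (Fin 2)

/-- The open unit disc `Ω`. -/
def disc : Set Plane := Metric.ball 0 1

/-- The point `(cos θ, sin θ)` of the unit circle. -/
def circlePoint (θ : ℝ) : Plane := !₂[Real.cos θ, Real.sin θ]

/-- The `i`-th partial derivative of a function on the plane. -/
def partialD (i : Fin 2) (φ : Plane → ℂ) (x : Plane) : ℂ :=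
  fderiv ℝ φ x (EuclideanSpace.single i 1)

/-- `u ∈ H¹(Ω)` with weak gradient `G`. -/
structure IsH1 (u : Plane → ℂ) (G : Fin 2 → Plane → ℂ) : Prop where
  memLp : MemLp u 2 (volume.restrict disc)
  grad_memLp : ∀ i, MemLp (G i) 2 (volume.restrict disc)
  weak_grad : ∀ (i : Fin 2) (φ : Plane → ℂ), ContDiff ℝ ∞ φ → HasCompactSupport φ →
    tsupport φ ⊆ disc → ∫ x in disc, u x * partialD i φ x = -∫ x in disc, G i x * φ x

/-- `t ∈ L²(∂Ω)`, a function of the angle `θ ∈ (-π, π]`, is the trace on the unit circle of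
`u ∈ H¹(Ω)` with weak gradient `G`, in the sense of the divergence theorem:
`∫_Ω (u ∂_i φ + G_i φ) = ∫_{∂Ω} t φ ν_i` for all smooth `φ` on the plane. -/
structure IsTrace (u : Plane → ℂ) (G : Fin 2 → Plane → ℂ) (t : ℝ → ℂ) : Prop where
  memLp : MemLp t 2 (volume.restrict (Ioc (-Real.pi) Real.pi))
  green : ∀ (i : Fin 2) (φ : Plane → ℂ), ContDiff ℝ ∞ φ →
    ∫ x in disc, (u x * partialD i φ x + G i x * φ x) =
      ∫ θ in Ioc (-Real.pi) Real.pi, t θ * φ (circlePoint θ) * ((circlePoint θ i : ℝ) : ℂ)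

/-- The `m`-th Fourier coefficient of a function of the angle. -/
def angularCoeff (t : ℝ → ℂ) (m : ℤ) : ℂ :=
  (1 / (2 * Real.pi : ℂ)) *
    ∫ θ in Ioc (-Real.pi) Real.pi, t θ * Complex.exp (-(Complex.I * (m : ℂ) * (θ : ℂ)))

/-- `k ∈ ℂ \ {0}` is a resonance: `k n(1)` is no zero of a Hankel function and there is a nonzero
`u ∈ H¹(Ω)` that solves `-Δu = (k n(|x|))² u` in `Ω \ {|x| = ξ}` with continuous Cauchy data across
`|x| = ξ` and `∂u/∂ν = T_{k n(1)} u` on `∂Ω`. This is expressed in weak form: for all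
`v ∈ H¹(Ω)`, the sesquilinear form
`∫_Ω ∇u · conj ∇v - k² ∫_Ω n² u conj v` equals `∫_{∂Ω} (T_{k n(1)} u) conj v`, where the latter is
`2π ∑_m (κ H_m'(κ) / H_m(κ)) u_m conj v_m` with `κ = k n(1)` and the Fourier coefficients
`u_m`, `v_m` of the traces of `u` and `v`. -/
def IsResonance (n : ℝ → ℝ) (n₂one : ℝ) (k : ℂ) : Prop :=
  k ≠ 0 ∧ (∀ m : ℤ, hankelH m (k * n₂one) ≠ 0) ∧
  ∃ (u : Plane → ℂ) (G : Fin 2 → Plane → ℂ) (t : ℝ → ℂ),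
    IsH1 u G ∧ IsTrace u G t ∧ ¬ (u =ᵐ[volume.restrict disc] 0) ∧
    ∀ (v : Plane → ℂ) (Gv : Fin 2 → Plane → ℂ) (tv : ℝ → ℂ), IsH1 v Gv → IsTrace v Gv tv →
      HasSum
        (fun m : ℤ => (2 * Real.pi : ℂ) * (dtnSymbol m (k * n₂one) * angularCoeff t m *
          (starRingEnd ℂ) (angularCoeff tv m)))
        ((∫ x in disc, ∑ i : Fin 2, G i x * (starRingEnd ℂ) (Gv i x))
          - k ^ 2 * ∫ x in disc, ((n ‖x‖ : ℝ) : ℂ) ^ 2 * u x * (starRingEnd ℂ) (v x))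

/-! ### The fundamental solutions -/

/-- The radial operator `L v = -(1/r) (r v')' + (m²/r² - (k n(r))²) v`. -/
def radialOp (n : ℝ → ℝ) (m : ℤ) (k : ℂ) (v : ℝ → ℂ) (r : ℝ) : ℂ :=
  -(1 / (r : ℂ)) * deriv (fun s : ℝ => (s : ℂ) * deriv v s) r
    + ((m : ℂ) ^ 2 / (r : ℂ) ^ 2 - (k * (n r : ℂ)) ^ 2) * v r

/-- `v` solves `L v = 0` in `(a,b)` classically: it is `C²` in `(a,b)` and `C¹` up to the end
points. -/
structure SolvesRadial (n : ℝ → ℝ) (m : ℤ) (k : ℂ) (a b : ℝ) (v : ℝ → ℂ) : Prop where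
  contDiff_one : ContDiffOn ℝ 1 v (Icc a b)
  contDiff_two : ContDiffOn ℝ 2 v (Ioo a b)
  eq_zero : ∀ r ∈ Ioo a b, radialOp n m k v r = 0

/-- The boundary value problem for `f_{1,1,k}` on `(0,ξ)` with datum `h`: `L f = 0` in `(0,ξ)`,
`f(0) = 0` for odd `m`, `f'(0) = 0` for even `m`, and `f'(ξ) - i k n₁(ξ) f(ξ) = h`. -/
structure SolvesInner (ξ : ℝ) (n : ℝ → ℝ) (n₁ξ : ℝ) (m : ℤ) (k h : ℂ) (f : ℝ → ℂ) : Prop where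
  solves : SolvesRadial n m k 0 ξ f
  at_zero_of_odd : Odd m → f 0 = 0
  at_zero_of_even : Even m → derivWithin f (Icc 0 ξ) 0 = 0
  robin : derivWithin f (Icc 0 ξ) ξ - Complex.I * k * n₁ξ * f ξ = h

/-- The boundary value problem for `f_{2,2,k}` on `(ξ,1)` with datum `h`: `L f = 0` in `(ξ,1)`,
`-f'(ξ) - i k n₂(ξ) f(ξ) = h`, and `f'(1) = κ H_m'(κ)/H_m(κ) f(1)` with `κ = k n₂(1)`. -/
structure SolvesOuter (ξ : ℝ) (n : ℝ → ℝ) (n₂ξ n₂one : ℝ) (m : ℤ) (k h : ℂ) (f : ℝ → ℂ) :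
    Prop where
  solves : SolvesRadial n m k ξ 1 f
  robin : -derivWithin f (Icc ξ 1) ξ - Complex.I * k * n₂ξ * f ξ = h
  dtn : derivWithin f (Icc ξ 1) 1 - dtnSymbol m (k * n₂one) * f 1 = 0

/-- For all `k ∈ U` the Dirichlet-to-Neumann symbol is defined and the two boundary value problems
with the data `h₁ k` and `h₂ k` have unique solutions (unique as functions on `[0,ξ]` and
`[ξ,1]`). -/
structure WellPosedOn (ξ : ℝ) (n : ℝ → ℝ) (n₁ξ n₂ξ n₂one : ℝ) (m : ℤ) (h₁ h₂ : ℂ → ℂ)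
    (U : Set ℂ) : Prop where
  hankel_ne_zero : ∀ k ∈ U, hankelH m (k * n₂one) ≠ 0
  inner_exists : ∀ k ∈ U, ∃ f, SolvesInner ξ n n₁ξ m k (h₁ k) f
  inner_unique : ∀ k ∈ U, ∀ f g, SolvesInner ξ n n₁ξ m k (h₁ k) f →
    SolvesInner ξ n n₁ξ m k (h₁ k) g → EqOn f g (Icc 0 ξ)
  outer_exists : ∀ k ∈ U, ∃ f, SolvesOuter ξ n n₂ξ n₂one m k (h₂ k) f
  outer_unique : ∀ k ∈ U, ∀ f g, SolvesOuter ξ n n₂ξ n₂one m k (h₂ k) f →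
    SolvesOuter ξ n n₂ξ n₂one m k (h₂ k) g → EqOn f g (Icc ξ 1)

/-- The matrix `T(k)` of the transmission conditions at `ξ` for `f₁ = f_{1,1,k}` on `(0,ξ)` and
`f₂ = f_{2,2,k}` on `(ξ,1)`. -/
def transmissionMatrix (ξ : ℝ) (f₁ f₂ : ℝ → ℂ) : Matrix (Fin 2) (Fin 2) ℂ :=
  !![f₁ ξ, -f₂ ξ; derivWithin f₁ (Icc 0 ξ) ξ, -derivWithin f₂ (Icc ξ 1) ξ]

/-- The function `det(k) = det T(k)` for families `f₁ k = f_{1,1,k}`, `f₂ k = f_{2,2,k}`. -/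
def detT (ξ : ℝ) (f₁ f₂ : ℂ → ℝ → ℂ) (k : ℂ) : ℂ :=
  (transmissionMatrix ξ (f₁ k) (f₂ k)).det

end

end RadialHelmholtz

open RadialHelmholtz

/-! With `μ = |m|`, the variables `z = r^{-μ} f` and `Y = r^μ (r f' - μ f)` turn `L_k f = 0` into
`z' = r^{-(2μ+1)} Y`, `Y' = -k² r^{2μ+1} n² z`. The wave number enters only through the scalar
factor `λ = k²`, so Picard iteration is a power series in `λ`; factorial bounds on the iterates make
it entire (`exists_entire_solution`). The kernel `(t/s)^{2μ+1} n(t)²` stays bounded for `t ≤ s`, so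
the iteration may start at the singular point `0`, where it produces the regular solution.

Nothing is assumed about how the given solutions depend on `k`; constancy of the Wronskian ties them
to the entire ones. On `(0,ξ)` the Wronskian with the regular solution tends to `0` at the origin,
so the Cauchy data at `ξ` are proportional to an entire nonzero vector
(`exists_entire_regular_data`). On `(ξ,1)` an entire transfer matrix carries the data from `1` to
`ξ` (`exists_entire_transfer`), with the data at `1` fixed up to a factor by the
Dirichlet-to-Neumann condition, whose symbol is holomorphic because `Im k < 0` avoids the branch
cut. In both cases the Robin condition determines the remaining factor as `h` over a holomorphic
function; that denominator cannot vanish, since a solution exists and `h ≠ 0`. Hence `det` is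
holomorphic, and the Newton statement is the classical local one at a simple zero
(`newton_quadratic_convergence`). -/

namespace RadialHelmholtz

/-! ### Linear Volterra systems with a parameter -/

/-- Coefficients `P`, `Q` on `(l, R)` of the system `w' = P y`, `y' = -λ Q w` with base point `c`,
which may be the left end point `l`, where `P` may be singular as long as `P(s) Q(t)` stays bounded
for `t` between `c` and `s`. -/
structure IsVolterraKernel (P Q : ℝ → ℂ) (l R c C : ℝ) : Prop where
  base_mem : c ∈ Ico l R
  continuousOn_P : ContinuousOn P (Ioo l R)
  continuousOn_Q : ContinuousOn Q (Ioo l R)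
  norm_Q_le : ∀ t ∈ Ioo l R, ‖Q t‖ ≤ C
  norm_mul_le : ∀ s ∈ Ioo l R, ∀ t ∈ uIoc c s, ‖P s * Q t‖ ≤ C

/-- The iterates `a_{j+1}(r) = ∫_c^r P(s) ∫_c^s Q(t) a_j(t) dt ds`. -/
noncomputable def volterraIter (P Q : ℝ → ℂ) (c : ℝ) (a₀ : ℝ → ℂ) : ℕ → ℝ → ℂ
  | 0 => a₀
  | j + 1 => fun r => ∫ s in c..r, P s * ∫ t in c..s, Q t * volterraIter P Q c a₀ j t

/-- For `c < s` the half-open interval omits `c`, so a bound replaces continuity at the base point.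
-/
lemma intervalIntegrable_of_continuousOn_of_norm_le {f : ℝ → ℂ} {J : Set ℝ} {c s M : ℝ}
    (hf : ContinuousOn f J) (hJ : uIoc c s ⊆ J) (hM : ∀ t ∈ uIoc c s, ‖f t‖ ≤ M) :
    IntervalIntegrable f volume c s := by
  rw [intervalIntegrable_iff]
  exact IntegrableOn.of_bound (by simp [uIoc])
    ((hf.mono hJ).aestronglyMeasurable measurableSet_uIoc) M
    ((ae_restrict_iff' measurableSet_uIoc).2 (Eventually.of_forall hM))

lemma hasDerivAt_integral_of_continuousOn {f : ℝ → ℂ} {J : Set ℝ} {c s : ℝ}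
    (hJ : IsOpen J) (hf : ContinuousOn f J) (hs : s ∈ J) (hi : IntervalIntegrable f volume c s) :
    HasDerivAt (fun u => ∫ t in c..u, f t) (f s) s :=
  intervalIntegral.integral_hasDerivAt_right hi
    (hf.stronglyMeasurableAtFilter hJ s hs) (hf.continuousAt (hJ.mem_nhds hs))

lemma abs_sub_le_of_mem_uIoc {c s t : ℝ} (ht : t ∈ uIoc c s) : |t - c| ≤ |s - c| := by
  have := abs_sub_left_of_mem_uIcc (uIoc_subset_uIcc ht)
  exact this

namespace IsVolterraKernel

variable {P Q : ℝ → ℂ} {l R c C : ℝ}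

lemma uIoc_subset (h : IsVolterraKernel P Q l R c C) {s : ℝ} (hs : s ∈ Ioo l R) :
    uIoc c s ⊆ Ioo l R := by
  intro t ht
  obtain ⟨h1, h2⟩ := h.base_mem
  rcases mem_uIoc.1 ht with ⟨h3, h4⟩ | ⟨h3, h4⟩
  · exact ⟨h1.trans_lt h3, h4.trans_lt hs.2⟩
  · exact ⟨hs.1.trans h3, h4.trans_lt h2⟩

lemma abs_sub_le (h : IsVolterraKernel P Q l R c C) {s : ℝ} (hs : s ∈ Ioo l R) :
    |s - c| ≤ R - l := by
  obtain ⟨h1, h2⟩ := h.base_mem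
  rw [abs_le]; constructor <;> linarith [hs.1, hs.2]

lemma nonneg (h : IsVolterraKernel P Q l R c C) : 0 ≤ C := by
  obtain ⟨h1, h2⟩ := h.base_mem
  exact (norm_nonneg _).trans (h.norm_Q_le ((c + R) / 2) ⟨by linarith, by linarith⟩)

variable {b : ℝ → ℂ} {M : ℝ} {j : ℕ}

lemma norm_le_of_mem_uIoc (h : IsVolterraKernel P Q l R c C) (hM : 0 ≤ M)
    (hb : ∀ t ∈ Ioo l R, ‖b t‖ ≤ M * |t - c| ^ j) {s : ℝ} (hs : s ∈ Ioo l R) {t : ℝ}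
    (ht : t ∈ uIoc c s) : ‖b t‖ ≤ M * |s - c| ^ j :=
  (hb t (h.uIoc_subset hs ht)).trans
    (mul_le_mul_of_nonneg_left (pow_le_pow_left₀ (abs_nonneg _) (abs_sub_le_of_mem_uIoc ht) j) hM)

lemma intervalIntegrable_inner (h : IsVolterraKernel P Q l R c C) (hM : 0 ≤ M)
    (hbc : ContinuousOn b (Ioo l R)) (hb : ∀ t ∈ Ioo l R, ‖b t‖ ≤ M * |t - c| ^ j)
    {s : ℝ} (hs : s ∈ Ioo l R) : IntervalIntegrable (fun t => Q t * b t) volume c s := by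
  refine intervalIntegrable_of_continuousOn_of_norm_le (h.continuousOn_Q.mul hbc)
    (h.uIoc_subset hs) (M := C * (M * |s - c| ^ j)) fun t ht => ?_
  rw [norm_mul]
  exact mul_le_mul (h.norm_Q_le t (h.uIoc_subset hs ht)) (h.norm_le_of_mem_uIoc hM hb hs ht)
    (norm_nonneg _) h.nonneg

lemma hasDerivAt_inner (h : IsVolterraKernel P Q l R c C) (hM : 0 ≤ M)
    (hbc : ContinuousOn b (Ioo l R)) (hb : ∀ t ∈ Ioo l R, ‖b t‖ ≤ M * |t - c| ^ j)
    {s : ℝ} (hs : s ∈ Ioo l R) :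
    HasDerivAt (fun u => ∫ t in c..u, Q t * b t) (Q s * b s) s :=
  hasDerivAt_integral_of_continuousOn isOpen_Ioo (h.continuousOn_Q.mul hbc) hs
    (h.intervalIntegrable_inner hM hbc hb hs)

lemma norm_inner_le (h : IsVolterraKernel P Q l R c C) (hM : 0 ≤ M)
    (hb : ∀ t ∈ Ioo l R, ‖b t‖ ≤ M * |t - c| ^ j) {s : ℝ} (hs : s ∈ Ioo l R) :
    ‖∫ t in c..s, Q t * b t‖ ≤ C * (M * |s - c| ^ j) * |s - c| := by
  refine intervalIntegral.norm_integral_le_of_norm_le_const fun t ht => ?_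
  rw [norm_mul]
  exact mul_le_mul (h.norm_Q_le t (h.uIoc_subset hs ht)) (h.norm_le_of_mem_uIoc hM hb hs ht)
    (norm_nonneg _) h.nonneg

lemma norm_mul_inner_le (h : IsVolterraKernel P Q l R c C) (hM : 0 ≤ M)
    (hb : ∀ t ∈ Ioo l R, ‖b t‖ ≤ M * |t - c| ^ j) {s : ℝ} (hs : s ∈ Ioo l R) :
    ‖P s * ∫ t in c..s, Q t * b t‖ ≤ C * (M * |s - c| ^ j) * |s - c| := by
  -- `P s` may blow up at `c`; only inside the integral can it be paired with `Q t`.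
  rw [← intervalIntegral.integral_const_mul]
  refine intervalIntegral.norm_integral_le_of_norm_le_const fun t ht => ?_
  rw [← mul_assoc, norm_mul]
  exact mul_le_mul (h.norm_mul_le s hs t ht) (h.norm_le_of_mem_uIoc hM hb hs ht)
    (norm_nonneg _) h.nonneg

lemma norm_mul_inner_le' (h : IsVolterraKernel P Q l R c C) (hM : 0 ≤ M)
    (hb : ∀ t ∈ Ioo l R, ‖b t‖ ≤ M * |t - c| ^ j) {s : ℝ} (hs : s ∈ Ioo l R) :
    ‖P s * ∫ t in c..s, Q t * b t‖ ≤ C * (R - l) * M * |s - c| ^ j := by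
  refine (h.norm_mul_inner_le hM hb hs).trans ?_
  have h1 := h.abs_sub_le hs
  have h2 := h.nonneg
  calc C * (M * |s - c| ^ j) * |s - c| ≤ C * (M * |s - c| ^ j) * (R - l) := by gcongr
    _ = _ := by ring

lemma continuousOn_mul_inner (h : IsVolterraKernel P Q l R c C) (hM : 0 ≤ M)
    (hbc : ContinuousOn b (Ioo l R)) (hb : ∀ t ∈ Ioo l R, ‖b t‖ ≤ M * |t - c| ^ j) :
    ContinuousOn (fun s => P s * ∫ t in c..s, Q t * b t) (Ioo l R) :=
  h.continuousOn_P.mul fun _ hs => (h.hasDerivAt_inner hM hbc hb hs).continuousAt.continuousWithinAt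

lemma hasDerivAt_outer (h : IsVolterraKernel P Q l R c C) (hM : 0 ≤ M)
    (hbc : ContinuousOn b (Ioo l R)) (hb : ∀ t ∈ Ioo l R, ‖b t‖ ≤ M * |t - c| ^ j)
    {r : ℝ} (hr : r ∈ Ioo l R) :
    HasDerivAt (fun u => ∫ s in c..u, P s * ∫ t in c..s, Q t * b t)
      (P r * ∫ t in c..r, Q t * b t) r := by
  refine hasDerivAt_integral_of_continuousOn isOpen_Ioo (h.continuousOn_mul_inner hM hbc hb) hr ?_
  have hlR : 0 ≤ R - l := by linarith [hr.1, hr.2]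
  have hC := h.nonneg
  refine intervalIntegrable_of_continuousOn_of_norm_le (h.continuousOn_mul_inner hM hbc hb)
    (h.uIoc_subset hr) (M := C * (R - l) * M * |r - c| ^ j) fun s hs => ?_
  refine (h.norm_mul_inner_le' hM hb (h.uIoc_subset hr hs)).trans ?_
  have := abs_sub_le_of_mem_uIoc hs
  gcongr

/-- Integrating `|s - c|^j` yields the factor `1/(j+1)` from which the factorial builds up. -/
lemma norm_outer_le (h : IsVolterraKernel P Q l R c C) (hM : 0 ≤ M)
    (hb : ∀ t ∈ Ioo l R, ‖b t‖ ≤ M * |t - c| ^ j) {r : ℝ} (hr : r ∈ Ioo l R) :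
    ‖∫ s in c..r, P s * ∫ t in c..s, Q t * b t‖ ≤
      C * (R - l) * M * (|r - c| ^ (j + 1) / (j + 1)) := by
  rw [intervalIntegral.norm_intervalIntegral_eq, ← integral_pow_abs_sub_uIoc,
    ← integral_const_mul]
  refine norm_integral_le_of_norm_le ?_ ?_
  · exact (Continuous.integrableOn_uIoc (by fun_prop))
  · exact (ae_restrict_iff' measurableSet_uIoc).2 (Eventually.of_forall fun s hs =>
      h.norm_mul_inner_le' hM hb (h.uIoc_subset hr hs))

/-- The factorial bound for the iterates. -/
lemma volterraIter_bound (h : IsVolterraKernel P Q l R c C) {a₀ : ℝ → ℂ} {A : ℝ}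
    (ha : ContinuousOn a₀ (Ioo l R)) (hA : ∀ r ∈ Ioo l R, ‖a₀ r‖ ≤ A) (hA0 : 0 ≤ A) (j : ℕ) :
    ContinuousOn (volterraIter P Q c a₀ j) (Ioo l R) ∧
      ∀ r ∈ Ioo l R, ‖volterraIter P Q c a₀ j r‖ ≤
        A * (C * (R - l)) ^ j / j.factorial * |r - c| ^ j := by
  have hlR : 0 ≤ R - l := by linarith [h.base_mem.1, h.base_mem.2]
  have hC := h.nonneg
  induction j with
  | zero => exact ⟨ha, fun r hr => by simpa [volterraIter] using hA r hr⟩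
  | succ j ih =>
    have hM : 0 ≤ A * (C * (R - l)) ^ j / j.factorial := by positivity
    refine ⟨fun r hr =>
      (h.hasDerivAt_outer hM ih.1 ih.2 hr).continuousAt.continuousWithinAt, fun r hr => ?_⟩
    refine (h.norm_outer_le hM ih.2 hr).trans (le_of_eq ?_)
    rw [Nat.factorial_succ]
    push_cast
    field_simp
    ring

/-- Solutions of the system `w' = P y`, `y' = -λ Q w` with leading part `(a₀, e)` that are entire
in `λ`. -/
theorem exists_entire_solution (h : IsVolterraKernel P Q l R c C) {a₀ : ℝ → ℂ} {A : ℝ} {e : ℂ}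
    (ha : ∀ r ∈ Ioo l R, HasDerivAt a₀ (P r * e) r) (hA : ∀ r ∈ Ioo l R, ‖a₀ r‖ ≤ A) :
    ∃ w y : ℂ → ℝ → ℂ,
      (∀ r ∈ Ioo l R, Differentiable ℂ (fun z => w z r) ∧ Differentiable ℂ (fun z => y z r)) ∧
      (∀ z, ∀ r ∈ Ioo l R, HasDerivAt (w z) (P r * y z r) r ∧
        HasDerivAt (y z) (-z * Q r * w z r) r) ∧
      ∀ z, ∃ M, ∀ r ∈ Ioo l R, ‖w z r - a₀ r‖ ≤ M * |r - c| ∧ ‖y z r - e‖ ≤ M * |r - c| ∧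
        ‖P r * (y z r - e)‖ ≤ M * |r - c| := by
  have hD : 0 < R - l := by linarith [h.base_mem.1, h.base_mem.2]
  have hC := h.nonneg
  have hr₀ : (l + R) / 2 ∈ Ioo l R := ⟨by linarith, by linarith⟩
  set r₀ := (l + R) / 2
  have hA0 : 0 ≤ A := (norm_nonneg _).trans (hA _ hr₀)
  have hac : ContinuousOn a₀ (Ioo l R) := fun r hr => (ha r hr).continuousAt.continuousWithinAt
  set a := volterraIter P Q c a₀
  set I : ℕ → ℝ → ℂ := fun j s => ∫ t in c..s, Q t * a j t
  set D := R - l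
  set m : ℕ → ℝ := fun j => A * (C * D) ^ j / j.factorial with hm
  have hm0 : ∀ j, 0 ≤ m j := fun j => by positivity
  have hb := h.volterraIter_bound hac hA hA0
  have habs : ∀ {r}, r ∈ Ioo l R → |r - c| ≤ D := fun hr => h.abs_sub_le hr
  have hba : ∀ j, ∀ r ∈ Ioo l R, ‖a j r‖ ≤ m j * D ^ j := fun j r hr =>
    ((hb j).2 r hr).trans (mul_le_mul_of_nonneg_left
      (pow_le_pow_left₀ (abs_nonneg _) (habs hr) j) (hm0 j))
  have hstep : ∀ j, ∀ r ∈ Ioo l R, C * (m j * |r - c| ^ j) * |r - c| ≤ C * (m j * D ^ j) * |r - c| :=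
    fun j r hr => by
      have := habs hr
      have := hm0 j
      gcongr
  have hI : ∀ j, ∀ r ∈ Ioo l R, ‖I j r‖ ≤ C * (m j * D ^ j) * |r - c| := fun j r hr =>
    (h.norm_inner_le (hm0 j) (hb j).2 hr).trans (hstep j r hr)
  have hPI : ∀ j, ∀ r ∈ Ioo l R, ‖P r * I j r‖ ≤ C * (m j * D ^ j) * |r - c| := fun j r hr =>
    (h.norm_mul_inner_le (hm0 j) (hb j).2 hr).trans (hstep j r hr)
  have haS : ∀ j, ∀ r ∈ Ioo l R, ‖a (j + 1) r‖ ≤ C * (m j * D ^ j) * D * |r - c| :=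
    fun j r hr => by
      refine (h.norm_outer_le (hm0 j) (hb j).2 hr).trans ?_
      have h1 : |r - c| ^ (j + 1) / ((j : ℝ) + 1) ≤ |r - c| ^ (j + 1) :=
        div_le_self (by positivity) (by linarith [(Nat.cast_nonneg j : (0 : ℝ) ≤ j)])
      have h2 : |r - c| ^ (j + 1) ≤ D ^ j * |r - c| := by
        rw [pow_succ]; have := habs hr; gcongr
      have := hm0 j
      calc C * D * m j * (|r - c| ^ (j + 1) / ((j : ℝ) + 1))
          ≤ C * D * m j * (D ^ j * |r - c|) := by gcongr; exact h1.trans h2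
        _ = _ := by ring
  -- The common majorant is `K A` times the exponential series at `L C D²`.
  have hsum : ∀ (L K : ℝ), Summable fun j => L ^ j * (K * (m j * D ^ j)) := fun L K => by
    refine ((Real.summable_pow_div_factorial (L * (C * D) * D)).mul_left (K * A)).congr fun j => ?_
    simp only [hm, mul_pow]; ring
  have hpow : ∀ {z : ℂ} {L : ℝ}, ‖z‖ ≤ L → ∀ j, ‖(-z) ^ j‖ ≤ L ^ j := fun hz j => by
    rw [norm_pow, norm_neg]; exact pow_le_pow_left₀ (norm_nonneg _) hz j
  have hI' : ∀ j, ∀ r ∈ Ioo l R, ‖I j r‖ ≤ C * D * (m j * D ^ j) := fun j r hr => by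
    refine (hI j r hr).trans ?_
    have := hm0 j
    calc C * (m j * D ^ j) * |r - c| ≤ C * (m j * D ^ j) * D := by gcongr; exact habs hr
      _ = _ := by ring
  have hPI' : ∀ j, ∀ r ∈ Ioo l R, ‖P r * I j r‖ ≤ C * D * (m j * D ^ j) := fun j r hr => by
    refine (hPI j r hr).trans ?_
    have := hm0 j
    calc C * (m j * D ^ j) * |r - c| ≤ C * (m j * D ^ j) * D := by gcongr; exact habs hr
      _ = _ := by ring
  have hsw : ∀ z, ∀ r ∈ Ioo l R, Summable fun j => (-z) ^ j * a j r := fun z r hr => by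
    refine .of_norm_bounded (hsum ‖z‖ 1) fun j => ?_
    rw [norm_mul, one_mul]
    exact mul_le_mul (hpow le_rfl j) (hba j r hr) (norm_nonneg _) (by positivity)
  have hsw1 : ∀ z, ∀ r ∈ Ioo l R, Summable fun j => (-z) ^ j * a (j + 1) r := fun z r hr => by
    refine .of_norm_bounded (hsum ‖z‖ (C * D * D)) fun j => ?_
    rw [norm_mul]
    have := hm0 j
    refine mul_le_mul (hpow le_rfl j) ((haS j r hr).trans ?_) (norm_nonneg _) (by positivity)
    calc C * (m j * D ^ j) * D * |r - c| ≤ C * (m j * D ^ j) * D * D := by gcongr; exact habs hr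
      _ = _ := by ring
  have hsy : ∀ z, ∀ r ∈ Ioo l R, Summable fun j => (-z) ^ j * I j r := fun z r hr => by
    refine .of_norm_bounded (hsum ‖z‖ (C * D)) fun j => ?_
    rw [norm_mul]
    exact mul_le_mul (hpow le_rfl j) (hI' j r hr) (norm_nonneg _) (by positivity)
  -- The term `a₀` is not an iterated integral: it is differentiated through its own hypothesis, and
  -- every other term is small at `c`.
  have hwsplit : ∀ z, ∀ r ∈ Ioo l R,
      ∑' j, (-z) ^ j * a j r = a₀ r + -z * ∑' j, (-z) ^ j * a (j + 1) r := fun z r hr => by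
    rw [(hsw z r hr).tsum_eq_zero_add, ← tsum_mul_left]
    simp only [pow_zero, one_mul, pow_succ']
    congr 1
    exact tsum_congr fun j => by ring
  -- Picard series: termwise, `a_{j+1}' = P I_j` and `I_j' = Q a_j`.
  refine ⟨fun z r => ∑' j, (-z) ^ j * a j r, fun z r => e + -z * ∑' j, (-z) ^ j * I j r,
    fun r hr => ⟨fun z => ?_, fun z => ?_⟩, fun z r hr => ⟨?_, ?_⟩, fun z => ?_⟩
  · refine (Complex.differentiableOn_tsum_of_summable_norm (U := Metric.ball 0 (‖z‖ + 1))
      (hsum (‖z‖ + 1) 1) (fun j => by fun_prop) Metric.isOpen_ball fun j x hx => ?_).differentiableAt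
        (Metric.isOpen_ball.mem_nhds (by simp))
    rw [norm_mul, one_mul]
    exact mul_le_mul (hpow (mem_ball_zero_iff.1 hx).le j) (hba j r hr) (norm_nonneg _) (by positivity)
  · refine (differentiableAt_const _).add (differentiableAt_id.neg.mul ?_)
    refine (Complex.differentiableOn_tsum_of_summable_norm (U := Metric.ball 0 (‖z‖ + 1))
      (hsum (‖z‖ + 1) (C * D)) (fun j => by fun_prop) Metric.isOpen_ball
        fun j x hx => ?_).differentiableAt (Metric.isOpen_ball.mem_nhds (by simp))
    rw [norm_mul]
    exact mul_le_mul (hpow (mem_ball_zero_iff.1 hx).le j) (hI' j r hr) (norm_nonneg _) (by positivity)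
  · have key : HasDerivAt (fun s => ∑' j, (-z) ^ j * a (j + 1) s)
        (∑' j, (-z) ^ j * (P r * I j r)) r := by
      refine hasDerivAt_tsum_of_isPreconnected (hsum ‖z‖ (C * D)) isOpen_Ioo isPreconnected_Ioo
        (g := fun j s => (-z) ^ j * a (j + 1) s) (g' := fun j s => (-z) ^ j * (P s * I j s))
        (fun j s hs => (h.hasDerivAt_outer (hm0 j) (hb j).1 (hb j).2 hs).const_mul _)
        (fun j s hs => ?_) hr₀ (hsw1 z _ hr₀) hr
      rw [norm_mul]
      exact mul_le_mul (hpow le_rfl j) (hPI' j s hs) (norm_nonneg _) (by positivity)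
    have := ((ha r hr).add (key.const_mul (-z))).congr_of_eventuallyEq
      (f₁ := fun s => ∑' j, (-z) ^ j * a j s)
      (eventually_of_mem (isOpen_Ioo.mem_nhds hr) fun s hs => hwsplit z s hs)
    refine this.congr_deriv ?_
    rw [mul_add, mul_left_comm, ← tsum_mul_left (a := P r)]
    congr 3
    exact funext fun j => by ring
  · have key : HasDerivAt (fun s => ∑' j, (-z) ^ j * I j s)
        (∑' j, (-z) ^ j * (Q r * a j r)) r := by
      refine hasDerivAt_tsum_of_isPreconnected (hsum ‖z‖ C) isOpen_Ioo isPreconnected_Ioo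
        (g := fun j s => (-z) ^ j * I j s) (g' := fun j s => (-z) ^ j * (Q s * a j s))
        (fun j s hs => (h.hasDerivAt_inner (hm0 j) (hb j).1 (hb j).2 hs).const_mul _)
        (fun j s hs => ?_) hr₀ (hsy z _ hr₀) hr
      rw [norm_mul, norm_mul]
      have := hm0 j
      exact mul_le_mul (hpow le_rfl j) (mul_le_mul (h.norm_Q_le s hs) (hba j s hs)
        (norm_nonneg _) hC) (by positivity) (by positivity)
    have := (key.const_mul (-z)).const_add e
    refine this.congr_deriv ?_
    rw [mul_assoc, ← tsum_mul_left (a := Q r)]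
    congr 2
    exact funext fun j => by ring
  -- These bounds encode the initial data at `c`, as values if `c` is interior and as limits if `c =
  -- l`; the third keeps control where `P` is singular.
  · have hS0 : ∀ K, 0 ≤ K → 0 ≤ ∑' j, ‖z‖ ^ j * (K * (m j * D ^ j)) := fun K hK =>
      tsum_nonneg fun j => by have := hm0 j; positivity
    set S₁ := ∑' j, ‖z‖ ^ j * (C * (m j * D ^ j))
    set S₂ := ∑' j, ‖z‖ ^ j * (C * D * (m j * D ^ j))
    have h₁ : 0 ≤ ‖z‖ * S₁ := mul_nonneg (norm_nonneg _) (hS0 _ hC)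
    have h₂ : 0 ≤ ‖z‖ * S₂ := mul_nonneg (norm_nonneg _) (hS0 _ (by positivity))
    have hgen : ∀ (K : ℝ) (g : ℕ → ℂ) (x : ℝ), (∀ j, ‖g j‖ ≤ K * (m j * D ^ j) * x) →
        ‖-z * ∑' j, (-z) ^ j * g j‖ ≤ ‖z‖ * (∑' j, ‖z‖ ^ j * (K * (m j * D ^ j))) * x := by
      intro K g x hg
      rw [norm_mul, norm_neg, mul_assoc]
      refine mul_le_mul_of_nonneg_left ?_ (norm_nonneg _)
      rw [← tsum_mul_right]
      refine tsum_of_norm_bounded ((hsum ‖z‖ K).mul_right x).hasSum fun j => ?_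
      rw [norm_mul, norm_pow, norm_neg, mul_assoc]
      exact mul_le_mul_of_nonneg_left (hg j) (by positivity)
    refine ⟨‖z‖ * S₁ + ‖z‖ * S₂, fun r hr => ⟨?_, ?_, ?_⟩⟩
    · simp only [hwsplit z r hr, add_sub_cancel_left]
      refine (hgen (C * D) _ |r - c| fun j => (haS j r hr).trans (le_of_eq (by ring))).trans ?_
      gcongr
      linarith
    · simp only [add_sub_cancel_left]
      refine (hgen C _ |r - c| fun j => hI j r hr).trans ?_
      gcongr
      linarith
    · simp only [add_sub_cancel_left]
      have : P r * (-z * ∑' j, (-z) ^ j * I j r) = -z * ∑' j, (-z) ^ j * (P r * I j r) := by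
        rw [mul_left_comm, ← tsum_mul_left (a := P r)]
        congr 2
        exact funext fun j => by ring
      rw [this]
      refine (hgen C _ |r - c| fun j => hPI j r hr).trans ?_
      gcongr
      linarith

end IsVolterraKernel

/-! ### Holomorphy of the Hankel functions in the lower half-plane -/

/-- Weierstrass' test on discs of radius `L`, with majorant `K L^m (L²)^j / j!`. It covers both
series in the Hankel function. -/
lemma differentiable_tsum_mul_half_pow (m : ℕ) {a : ℕ → ℂ} {K : ℝ}
    (ha : ∀ j, ‖a j‖ ≤ K / j.factorial) :
    Differentiable ℂ fun z : ℂ => ∑' j : ℕ, a j * (z / 2) ^ (2 * j + m) := by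
  intro z
  set L := ‖z‖ + 1
  have hs : Summable fun j : ℕ => K / j.factorial * L ^ (2 * j + m) := by
    refine ((Real.summable_pow_div_factorial (L ^ 2)).mul_left (K * L ^ m)).congr fun j => ?_
    rw [pow_add, pow_mul]; ring
  refine (Complex.differentiableOn_tsum_of_summable_norm (U := Metric.ball 0 L) hs
    (fun j => by fun_prop) Metric.isOpen_ball fun j x hx => ?_).differentiableAt
      (Metric.isOpen_ball.mem_nhds (by simp [L]))
  rw [norm_mul, norm_pow]
  refine mul_le_mul (ha j) (pow_le_pow_left₀ (norm_nonneg _) ?_ _) (by positivity)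
    ((norm_nonneg _).trans (ha j))
  have := mem_ball_zero_iff.1 hx
  rw [norm_div, Complex.norm_two]
  linarith [norm_nonneg x]

lemma norm_besselCoeff (m j : ℕ) :
    ‖(-1 : ℂ) ^ j / ((j.factorial : ℂ) * ((m + j).factorial : ℂ))‖ =
      1 / (m + j).factorial / j.factorial := by
  simp only [norm_div, norm_pow, norm_neg, norm_one, one_pow, norm_mul, Complex.norm_natCast]
  rw [div_div, mul_comm]

lemma differentiable_besselJ (m : ℕ) : Differentiable ℂ (besselJ m) := by
  refine differentiable_tsum_mul_half_pow m (K := 1) fun j => ?_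
  rw [norm_besselCoeff]
  gcongr
  exact div_le_one_of_le₀ (by exact_mod_cast (m + j).factorial_pos) (by positivity)

lemma abs_digammaSucc_le (j : ℕ) : |digammaSucc j| ≤ j + 1 := by
  have h0 : (0 : ℝ) ≤ harmonic j ∧ (harmonic j : ℝ) ≤ j := by
    induction j with
    | zero => simp
    | succ j ih =>
      rw [harmonic_succ]
      push_cast
      have h1 : (0 : ℝ) ≤ ((j : ℝ) + 1)⁻¹ := by positivity
      have h2 : ((j : ℝ) + 1)⁻¹ ≤ 1 := inv_le_one_of_one_le₀ (by linarith [j.cast_nonneg (α := ℝ)])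
      constructor <;> linarith
  have h1 := Real.one_half_lt_eulerMascheroniConstant
  have h2 := Real.eulerMascheroniConstant_lt_two_thirds
  rw [digammaSucc, abs_le]
  constructor <;> linarith

lemma differentiable_digamma_series (m : ℕ) :
    Differentiable ℂ fun z : ℂ => ∑' j : ℕ, ((digammaSucc j + digammaSucc (m + j) : ℝ) : ℂ) *
      ((-1 : ℂ) ^ j / ((j.factorial : ℂ) * ((m + j).factorial : ℂ)) * (z / 2) ^ (2 * j + m)) := by
  simp only [← mul_assoc]
  -- The digamma factor is at most `m + 2j + 2 ≤ 4 (m+j)!`, which the factor `1/(m+j)!` absorbs.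
  refine differentiable_tsum_mul_half_pow m (K := 4) fun j => ?_
  rw [norm_mul, norm_besselCoeff, Complex.norm_real, Real.norm_eq_abs, ← mul_div_assoc]
  gcongr
  have h1 := abs_digammaSucc_le j
  have h2 := abs_digammaSucc_le (m + j)
  have h3 := abs_add_le (digammaSucc j) (digammaSucc (m + j))
  have h4 : ((m + j : ℕ) : ℝ) ≤ (m + j).factorial := by exact_mod_cast Nat.self_le_factorial _
  have h5 : (1 : ℝ) ≤ (m + j).factorial := by exact_mod_cast (m + j).factorial_pos
  have h6 : (0 : ℝ) ≤ m := m.cast_nonneg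
  rw [mul_one_div, div_le_iff₀ (by linarith)]
  push_cast at h2 h4
  linarith

lemma isOpen_setOf_im_neg : IsOpen {z : ℂ | z.im < 0} :=
  isOpen_lt Complex.continuous_im continuous_const

/-- A negative imaginary part keeps `z/2` off the cut of the logarithm and away from the pole of the
finite sum. -/
lemma differentiableAt_besselY (m : ℕ) {z : ℂ} (hz : z.im < 0) :
    DifferentiableAt ℂ (besselY m) z := by
  have hz0 : z / 2 ≠ 0 := fun h => by
    have : z = 0 := by simpa using h
    simp [this] at hz
  have hslit : z / 2 ∈ Complex.slitPlane := by
    rw [Complex.mem_slitPlane_iff]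
    right
    have : (z / 2).im = z.im / 2 := by simp
    rw [this]
    exact (div_neg_of_neg_of_pos hz two_pos).ne
  have hlog : DifferentiableAt ℂ (fun z : ℂ => Complex.log (z / 2)) z :=
    (differentiableAt_id.div_const 2).clog hslit
  have hfin : DifferentiableAt ℂ (fun z : ℂ => ∑ j ∈ Finset.range m,
      ((m - j - 1).factorial : ℂ) / (j.factorial : ℂ) * (z / 2) ^ (2 * (j : ℤ) - (m : ℤ))) z :=
    DifferentiableAt.fun_sum fun j _ => by
      have hhalf : DifferentiableAt ℂ (fun z : ℂ => z / 2) z := by fun_prop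
      refine DifferentiableAt.const_mul ?_ _
      exact hhalf.zpow (Or.inl hz0)
  have hmain := (((hlog.const_mul 2).fun_mul (differentiable_besselJ m z)).fun_sub hfin).fun_sub
    (differentiable_digamma_series m z)
  unfold besselY
  exact hmain.const_mul _

lemma differentiableOn_hankelH (m : ℤ) : DifferentiableOn ℂ (hankelH m) {z | z.im < 0} :=
  fun z hz => (((differentiable_besselJ m.natAbs z).fun_add
    ((differentiableAt_besselY m.natAbs hz).const_mul _)).const_mul _).differentiableWithinAt

lemma differentiableOn_dtnSymbol (m : ℤ) {a : ℝ} (ha : 0 < a) {U : Set ℂ}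
    (hU : ∀ k ∈ U, k.im < 0) (hH : ∀ k ∈ U, hankelH m (k * a) ≠ 0) :
    DifferentiableOn ℂ (fun k => dtnSymbol m (k * a)) U := by
  intro k hk
  have him : (k * a).im < 0 := by
    simpa using mul_neg_of_neg_of_pos (hU k hk) ha
  have h1 := (differentiableOn_hankelH m).differentiableAt (isOpen_setOf_im_neg.mem_nhds him)
  have h2 := ((differentiableOn_hankelH m).deriv isOpen_setOf_im_neg).differentiableAt
    (isOpen_setOf_im_neg.mem_nhds him)
  have h3 : DifferentiableAt ℂ (dtnSymbol m) (k * a) := (differentiableAt_id.mul h2).div h1 (hH k hk)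
  exact (h3.comp k (by fun_prop : DifferentiableAt ℂ (fun k : ℂ => k * (a : ℂ)) k)).differentiableWithinAt

/-! ### Newton's method at a simple root of a holomorphic function -/

/-- The Newton error times `g'(z)` is `(g'(z) - g'(p))(z - p)` minus the first-order Taylor
remainder of `g` at `p`. Each is at most `K |z - p|²`, where `K` is a local Lipschitz constant of
`g'` at `p`, and `|g'(z)| > |g'(p)|/2` nearby. -/
lemma newton_error_bound {g : ℂ → ℂ} {U : Set ℂ} {p : ℂ} (hU : IsOpen U) (hp : p ∈ U)
    (hg : DifferentiableOn ℂ g U) (h0 : g p = 0) (h1 : deriv g p ≠ 0) :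
    ∃ ε > 0, ∃ C > 0, Metric.ball p ε ⊆ U ∧ ∀ z ∈ Metric.ball p ε, deriv g z ≠ 0 ∧
      ‖z - g z / deriv g z - p‖ ≤ C * ‖z - p‖ ^ 2 := by
  have hd : DifferentiableAt ℂ (deriv g) p := (hg.deriv hU).differentiableAt (hU.mem_nhds hp)
  obtain ⟨K, hK0, hK⟩ := hd.isBigO_sub.exists_pos
  have hhalf : ∀ᶠ z in 𝓝 p, ‖deriv g p‖ / 2 < ‖deriv g z‖ :=
    hd.continuousAt.norm.eventually (lt_mem_nhds (half_lt_self (norm_pos_iff.2 h1)))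
  obtain ⟨ε, hε, hball⟩ := Metric.eventually_nhds_iff_ball.1
    ((hK.bound.and hhalf).and (hU.mem_nhds hp))
  have hpos : 0 < ‖deriv g p‖ := norm_pos_iff.2 h1
  refine ⟨ε, hε, 2 * K / (‖deriv g p‖ / 2), by positivity, fun z hz => (hball z hz).2,
    fun z hz => ?_⟩
  have hz1 := (hball z hz).1.2
  have hz0 : deriv g z ≠ 0 := norm_pos_iff.1 ((half_pos hpos).trans hz1)
  refine ⟨hz0, ?_⟩
  have hmean : ‖(g z - deriv g p * z) - (g p - deriv g p * p)‖ ≤ K * ‖z - p‖ * ‖z - p‖ := by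
    have hsub : Metric.closedBall p ‖z - p‖ ⊆ Metric.ball p ε :=
      Metric.closedBall_subset_ball (by simpa [dist_eq_norm] using hz)
    refine (convex_closedBall p ‖z - p‖).norm_image_sub_le_of_norm_hasDerivWithin_le
      (f := fun z => g z - deriv g p * z) (f' := fun x => deriv g x - deriv g p)
      (fun x hx => ?_) (fun x hx => ?_)
      (Metric.mem_closedBall_self (norm_nonneg _)) (by simp [dist_eq_norm])
    · have hgx := (hg.differentiableAt (hU.mem_nhds (hball x (hsub hx)).2)).hasDerivAt
      simpa using (hgx.fun_sub ((hasDerivAt_id' x).const_mul (deriv g p))).hasDerivWithinAt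
    · refine (hball x (hsub hx)).1.1.trans (mul_le_mul_of_nonneg_left ?_ hK0.le)
      simpa [dist_eq_norm] using hx
  have hsplit : z - g z / deriv g z - p =
      ((deriv g z - deriv g p) * (z - p) -
        ((g z - deriv g p * z) - (g p - deriv g p * p))) / deriv g z := by
    rw [h0, eq_div_iff hz0]
    field_simp
    ring
  rw [hsplit, norm_div, div_le_iff₀ (norm_pos_iff.2 hz0)]
  have hb : ‖(deriv g z - deriv g p) * (z - p)‖ ≤ K * ‖z - p‖ * ‖z - p‖ := by
    rw [norm_mul]
    exact mul_le_mul_of_nonneg_right (hball z hz).1.1 (norm_nonneg _)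
  calc _ ≤ 2 * K * ‖z - p‖ ^ 2 := (norm_sub_le _ _).trans (by nlinarith)
    _ = 2 * K / (‖deriv g p‖ / 2) * ‖z - p‖ ^ 2 * (‖deriv g p‖ / 2) := by field_simp
    _ ≤ _ := by gcongr

/-- Local quadratic convergence of Newton's method. -/
theorem newton_quadratic_convergence {g : ℂ → ℂ} {U : Set ℂ} {p : ℂ} (hU : IsOpen U) (hp : p ∈ U)
    (hg : DifferentiableOn ℂ g U) (h0 : g p = 0) (h1 : deriv g p ≠ 0) :
    ∃ δ > 0, ∃ C : ℝ, Metric.ball p δ ⊆ U ∧ ∀ κ : ℕ → ℂ, κ 0 ∈ Metric.ball p δ →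
      (∀ l, κ (l + 1) = κ l - g (κ l) / deriv g (κ l)) →
      (∀ l, κ l ∈ Metric.ball p δ ∧ deriv g (κ l) ≠ 0) ∧ Tendsto κ atTop (𝓝 p) ∧
        ∀ l, ‖κ (l + 1) - p‖ ≤ C * ‖κ l - p‖ ^ 2 := by
  obtain ⟨ε, hε, C, hC, hsub, hN⟩ := newton_error_bound hU hp hg h0 h1
  -- Within `1/(2C)` of `p` the quadratic bound makes each step at least halve the error.
  refine ⟨min ε (1 / (2 * C)), by positivity, C,
    (Metric.ball_subset_ball (min_le_left _ _)).trans hsub, fun κ hκ0 hκ => ?_⟩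
  have hstep : ∀ z ∈ Metric.ball p (min ε (1 / (2 * C))),
      ‖z - g z / deriv g z - p‖ ≤ 1 / 2 * ‖z - p‖ := fun z hz => by
    have hz' : ‖z - p‖ < min ε (1 / (2 * C)) := by simpa [dist_eq_norm] using hz
    have h2 : C * ‖z - p‖ ≤ 1 / 2 := by
      have := (hz'.trans_le (min_le_right _ _)).le
      rw [le_div_iff₀ (by positivity)] at this
      linarith
    refine (hN z (Metric.ball_subset_ball (min_le_left _ _) hz)).2.trans ?_
    rw [pow_two, ← mul_assoc]
    exact mul_le_mul_of_nonneg_right h2 (norm_nonneg _)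
  have hmem : ∀ l, κ l ∈ Metric.ball p (min ε (1 / (2 * C))) := fun l => by
    induction l with
    | zero => exact hκ0
    | succ l ih =>
      have h2 := hstep _ ih
      rw [← hκ l] at h2
      rw [mem_ball_iff_norm] at ih ⊢
      linarith [norm_nonneg (κ l - p)]
  have hN' := fun l => hN _ (Metric.ball_subset_ball (min_le_left _ _) (hmem l))
  refine ⟨fun l => ⟨hmem l, (hN' l).1⟩, ?_, fun l => by rw [hκ l]; exact (hN' l).2⟩
  have hgeo : ∀ l, ‖κ l - p‖ ≤ (1 / 2) ^ l * ‖κ 0 - p‖ := fun l => by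
    induction l with
    | zero => simp
    | succ l ih =>
      have h2 := hstep _ (hmem l)
      rw [← hκ l] at h2
      rw [pow_succ']
      linarith
  rw [tendsto_iff_norm_sub_tendsto_zero]
  refine squeeze_zero (fun _ => norm_nonneg _) hgeo ?_
  simpa using (tendsto_pow_atTop_nhds_zero_of_lt_one (r := (1 / 2 : ℝ)) (by norm_num)
    (by norm_num)).mul_const ‖κ 0 - p‖

/-! ### The radial equation as a first order system -/

/-- `(z, Y)` solves `z' = P Y`, `Y' = -λ Q z` on `J`. -/
def SolvesSystem (P Q : ℝ → ℂ) (lam : ℂ) (J : Set ℝ) (z Y : ℝ → ℂ) : Prop :=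
  ∀ r ∈ J, HasDerivAt z (P r * Y r) r ∧ HasDerivAt Y (-lam * Q r * z r) r

lemma SolvesSystem.mono {P Q : ℝ → ℂ} {lam : ℂ} {J J' : Set ℝ} {z Y : ℝ → ℂ}
    (h : SolvesSystem P Q lam J z Y) (hJ : J' ⊆ J) : SolvesSystem P Q lam J' z Y :=
  fun r hr => h r (hJ hr)

lemma SolvesSystem.continuousOn {P Q : ℝ → ℂ} {lam : ℂ} {J : Set ℝ} {z Y : ℝ → ℂ}
    (h : SolvesSystem P Q lam J z Y) : ContinuousOn z J ∧ ContinuousOn Y J :=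
  ⟨fun r hr => (h r hr).1.continuousAt.continuousWithinAt,
    fun r hr => (h r hr).2.continuousAt.continuousWithinAt⟩

/-- The Wronskian of two solutions is constant. -/
lemma SolvesSystem.wronskian_eq {P Q : ℝ → ℂ} {lam : ℂ} {a b : ℝ} {z Y w y : ℝ → ℂ} (hab : a < b)
    (h : SolvesSystem P Q lam (Ioo a b) z Y) (h' : SolvesSystem P Q lam (Ioo a b) w y)
    (hz : ContinuousOn z (Icc a b)) (hY : ContinuousOn Y (Icc a b))
    (hw : ContinuousOn w (Icc a b)) (hy : ContinuousOn y (Icc a b)) :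
    z a * y a - Y a * w a = z b * y b - Y b * w b := by
  have hder : ∀ r ∈ Ioo a b, HasDerivAt (fun r => z r * y r - Y r * w r) 0 r := fun r hr =>
    (((h r hr).1.fun_mul (h' r hr).2).fun_sub ((h r hr).2.fun_mul (h' r hr).1)).congr_deriv
      (by ring)
  obtain ⟨C, hC⟩ := isOpen_Ioo.exists_is_const_of_deriv_eq_zero isPreconnected_Ioo
    (fun r hr => (hder r hr).differentiableAt.differentiableWithinAt) fun r hr => (hder r hr).deriv
  have hcl : EqOn (fun r => z r * y r - Y r * w r) (fun _ => C) (Icc a b) :=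
    EqOn.of_subset_closure hC ((hz.mul hy).sub (hY.mul hw)) continuousOn_const Ioo_subset_Icc_self
      (by rw [closure_Ioo hab.ne])
  exact (hcl (left_mem_Icc.2 hab.le)).trans (hcl (right_mem_Icc.2 hab.le)).symm

/-- The coefficient `r^{-(2μ+1)}`. -/
noncomputable def radialP (μ : ℕ) (r : ℝ) : ℂ := ((r : ℂ) ^ (2 * μ + 1))⁻¹

/-- The coefficient `r^{2μ+1} ν(r)`. -/
noncomputable def radialQ (μ : ℕ) (ν : ℝ → ℝ) (r : ℝ) : ℂ := (r : ℂ) ^ (2 * μ + 1) * (ν r : ℂ)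

lemma continuousOn_radialP (μ : ℕ) {J : Set ℝ} (hJ : J ⊆ Ioi 0) : ContinuousOn (radialP μ) J :=
  ContinuousOn.inv₀ (by fun_prop) fun r hr => by
    have : (r : ℂ) ≠ 0 := by exact_mod_cast (hJ hr).ne'
    positivity

lemma continuousOn_radialQ (μ : ℕ) {ν : ℝ → ℝ} {J : Set ℝ} (hν : ContinuousOn ν J) :
    ContinuousOn (radialQ μ ν) J :=
  ContinuousOn.mul (by fun_prop) (Complex.continuous_ofReal.comp_continuousOn hν)

lemma norm_radialQ_le (μ : ℕ) {ν : ℝ → ℝ} {N R t : ℝ} (hN : |ν t| ≤ N) (ht : 0 < t) (htR : t ≤ R) :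
    ‖radialQ μ ν t‖ ≤ R ^ (2 * μ + 1) * N := by
  have hR : 0 ≤ R := ht.le.trans htR
  rw [radialQ, norm_mul, norm_pow, Complex.norm_real, Complex.norm_real, Real.norm_eq_abs,
    Real.norm_eq_abs, abs_of_pos ht]
  gcongr

lemma norm_radialP (μ : ℕ) {s : ℝ} (hs : 0 < s) : ‖radialP μ s‖ = (s ^ (2 * μ + 1))⁻¹ := by
  rw [radialP, norm_inv, norm_pow, Complex.norm_real, Real.norm_eq_abs, abs_of_pos hs]

/-- For `0 < t ≤ s` one has `P(s) Q(t) = (t/s)^{2μ+1} ν(t)`, so the singularity of `P` at the base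
point cancels. -/
lemma isVolterraKernel_zero (μ : ℕ) {ν : ℝ → ℝ} {N R : ℝ} (hR : 0 < R)
    (hν : ContinuousOn ν (Ioi 0)) (hN : ∀ r > 0, |ν r| ≤ N) :
    IsVolterraKernel (radialP μ) (radialQ μ ν) 0 R 0 (max N (R ^ (2 * μ + 1) * N)) where
  base_mem := ⟨le_rfl, hR⟩
  continuousOn_P := continuousOn_radialP μ fun _ h => h.1
  continuousOn_Q := continuousOn_radialQ μ (hν.mono fun _ h => h.1)
  norm_Q_le t ht := (norm_radialQ_le μ (hN t ht.1) ht.1 ht.2.le).trans (le_max_right _ _)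
  norm_mul_le s hs t ht := by
    rw [uIoc_of_le hs.1.le] at ht
    refine le_trans ?_ (le_max_left _ _)
    rw [norm_mul, norm_radialP μ hs.1, inv_mul_le_iff₀ (pow_pos hs.1 _)]
    exact norm_radialQ_le μ (hN t ht.1) ht.1 ht.2

lemma isVolterraKernel_pos (μ : ℕ) {ν : ℝ → ℝ} {N l c R : ℝ} (hl : 0 < l) (hc : c ∈ Ico l R)
    (hν : ContinuousOn ν (Ioi 0)) (hN : ∀ r > 0, |ν r| ≤ N) :
    IsVolterraKernel (radialP μ) (radialQ μ ν) l R c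
      (max (R ^ (2 * μ + 1) * N) ((l ^ (2 * μ + 1))⁻¹ * (R ^ (2 * μ + 1) * N))) where
  base_mem := hc
  continuousOn_P := continuousOn_radialP μ fun _ h => hl.trans h.1
  continuousOn_Q := continuousOn_radialQ μ (hν.mono fun _ h => hl.trans h.1)
  norm_Q_le t ht := (norm_radialQ_le μ (hN t (hl.trans ht.1)) (hl.trans ht.1) ht.2.le).trans
    (le_max_left _ _)
  norm_mul_le s hs t ht := by
    have ht' : l < t ∧ t ≤ R := by
      rcases mem_uIoc.1 ht with ⟨h3, h4⟩ | ⟨h3, h4⟩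
      · exact ⟨hc.1.trans_lt h3, h4.trans hs.2.le⟩
      · exact ⟨hs.1.trans h3, h4.trans hc.2.le⟩
    have ht0 := hl.trans ht'.1
    refine le_trans ?_ (le_max_right _ _)
    rw [norm_mul, norm_radialP μ (hl.trans hs.1)]
    refine mul_le_mul ?_ (norm_radialQ_le μ (hN t ht0) ht0 ht'.2) (norm_nonneg _)
      (by positivity)
    have := hs.1.le
    gcongr

/-- The Cauchy data at `a` depend on those at `b` through a matrix that is entire in `λ`. -/
theorem exists_entire_transfer (μ : ℕ) {ν : ℝ → ℝ} {N a b : ℝ} (ha : 0 < a) (hab : a < b)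
    (hν : ContinuousOn ν (Ioi 0)) (hN : ∀ r > 0, |ν r| ≤ N) :
    ∃ w₁ y₁ w₂ y₂ : ℂ → ℂ, Differentiable ℂ w₁ ∧ Differentiable ℂ y₁ ∧ Differentiable ℂ w₂ ∧
      Differentiable ℂ y₂ ∧ ∀ (lam : ℂ) (z Y : ℝ → ℂ),
        SolvesSystem (radialP μ) (radialQ μ ν) lam (Ioo a b) z Y →
        ContinuousOn z (Icc a b) → ContinuousOn Y (Icc a b) →
        z a = w₁ lam * z b + w₂ lam * Y b ∧ Y a = y₁ lam * z b + y₂ lam * Y b := by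
  have hb : 0 < b := ha.trans hab
  -- The interval is enlarged so that `a` and `b` both lie in its interior.
  have hK := isVolterraKernel_pos μ (l := a / 2) (c := b) (R := 2 * b) (by positivity)
    ⟨by linarith, by linarith⟩ hν hN
  have hP : ContinuousOn (radialP μ) (Ioo (a / 2) (2 * b)) := hK.continuousOn_P
  have hPn : ∀ s ∈ Ioo (a / 2) (2 * b), ‖radialP μ s‖ ≤ ((a / 2) ^ (2 * μ + 1))⁻¹ := fun s hs => by
    rw [norm_radialP μ (by linarith [hs.1])]
    have := hs.1.le
    gcongr
  -- Fundamental system with data `(1,0)` and `(0,1)` at `b`; for the second, `a₀' = P` forces `a₀ =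
  -- ∫_b^r P`.
  obtain ⟨w₁, y₁, hd₁, hs₁, hb₁⟩ := hK.exists_entire_solution (a₀ := fun _ => 1) (A := 1) (e := 0)
    (fun r _ => by simpa using hasDerivAt_const r (1 : ℂ)) (fun r _ => by simp)
  obtain ⟨w₂, y₂, hd₂, hs₂, hb₂⟩ := hK.exists_entire_solution
    (a₀ := fun r => ∫ s in b..r, radialP μ s) (A := ((a / 2) ^ (2 * μ + 1))⁻¹ * (2 * b - a / 2))
    (e := 1) (fun r hr => by
      rw [mul_one]
      exact hasDerivAt_integral_of_continuousOn isOpen_Ioo hP hr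
        (intervalIntegrable_of_continuousOn_of_norm_le hP (hK.uIoc_subset hr)
          fun t ht => hPn t (hK.uIoc_subset hr ht))) (fun r hr => by
      refine (intervalIntegral.norm_integral_le_of_norm_le_const fun t ht =>
        hPn t (hK.uIoc_subset hr ht)).trans ?_
      have := hK.abs_sub_le hr
      gcongr)
  have hbJ : b ∈ Ioo (a / 2) (2 * b) := ⟨by linarith, by linarith⟩
  have haJ : a ∈ Ioo (a / 2) (2 * b) := ⟨by linarith, by linarith⟩
  have hsub : Icc a b ⊆ Ioo (a / 2) (2 * b) := fun r hr => ⟨by linarith [hr.1], by linarith [hr.2]⟩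
  have hbase₁ : ∀ lam, w₁ lam b = 1 ∧ y₁ lam b = 0 := fun lam => by
    obtain ⟨M, hM⟩ := hb₁ lam
    have := hM b hbJ
    simp only [sub_self, abs_zero, mul_zero, norm_le_zero_iff, sub_eq_zero] at this
    exact ⟨this.1, this.2.1⟩
  have hbase₂ : ∀ lam, w₂ lam b = 0 ∧ y₂ lam b = 1 := fun lam => by
    obtain ⟨M, hM⟩ := hb₂ lam
    have := hM b hbJ
    simp only [sub_self, abs_zero, mul_zero, norm_le_zero_iff, sub_eq_zero,
      intervalIntegral.integral_same] at this
    exact ⟨this.1, this.2.1⟩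
  refine ⟨fun lam => w₁ lam a, fun lam => y₁ lam a, fun lam => w₂ lam a, fun lam => y₂ lam a,
    (hd₁ a haJ).1, (hd₁ a haJ).2, (hd₂ a haJ).1, (hd₂ a haJ).2, fun lam z Y h hz hY => ?_⟩
  have S₁ : SolvesSystem (radialP μ) (radialQ μ ν) lam (Ioo (a / 2) (2 * b)) (w₁ lam) (y₁ lam) :=
    hs₁ lam
  have S₂ : SolvesSystem (radialP μ) (radialQ μ ν) lam (Ioo (a / 2) (2 * b)) (w₂ lam) (y₂ lam) :=
    hs₂ lam
  have T₁ := S₁.mono (Ioo_subset_Icc_self.trans hsub)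
  have T₂ := S₂.mono (Ioo_subset_Icc_self.trans hsub)
  have cw₁ := S₁.continuousOn.1.mono hsub
  have cy₁ := S₁.continuousOn.2.mono hsub
  have cw₂ := S₂.continuousOn.1.mono hsub
  have cy₂ := S₂.continuousOn.2.mono hsub
  -- `e₃` says that the fundamental matrix has determinant `1` at `a`; the conclusion is then
  -- Cramer's rule.
  have e₁ := h.wronskian_eq hab T₁ hz hY cw₁ cy₁
  have e₂ := h.wronskian_eq hab T₂ hz hY cw₂ cy₂
  have e₃ := T₁.wronskian_eq hab T₂ cw₁ cy₁ cw₂ cy₂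
  rw [(hbase₁ lam).1, (hbase₁ lam).2] at e₁ e₃
  rw [(hbase₂ lam).1, (hbase₂ lam).2] at e₂ e₃
  constructor
  · linear_combination (-z a) * e₃ + w₁ lam a * e₂ - w₂ lam a * e₁
  · linear_combination (-Y a) * e₃ + y₁ lam a * e₂ - y₂ lam a * e₁

/-- The Cauchy data at `b` of the solutions that are regular at `0` are multiples of a nonzero
vector that is entire in `λ`. -/
theorem exists_entire_regular_data (μ : ℕ) {ν : ℝ → ℝ} {N b : ℝ} (hb : 0 < b)
    (hν : ContinuousOn ν (Ioi 0)) (hN : ∀ r > 0, |ν r| ≤ N) :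
    ∃ w y : ℂ → ℂ, Differentiable ℂ w ∧ Differentiable ℂ y ∧
      (∀ lam, w lam ≠ 0 ∨ y lam ≠ 0) ∧ ∀ (lam : ℂ) (z Y : ℝ → ℂ),
        SolvesSystem (radialP μ) (radialQ μ ν) lam (Ioo 0 b) z Y →
        ContinuousOn z (Ioc 0 b) → ContinuousOn Y (Ioc 0 b) →
        Tendsto Y (𝓝[>] 0) (𝓝 0) →
        Tendsto (fun r : ℝ => z r * (r : ℂ) ^ (2 * μ + 1)) (𝓝[>] 0) (𝓝 0) →
        z b * y lam = Y b * w lam := by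
  have hK := isVolterraKernel_zero μ (R := 2 * b) (by positivity) hν hN
  obtain ⟨w, y, hd, hs, hbd⟩ := hK.exists_entire_solution (a₀ := fun _ => 1) (A := 1) (e := 0)
    (fun r _ => by simpa using hasDerivAt_const r (1 : ℂ)) (fun r _ => by simp)
  have hbJ : b ∈ Ioo 0 (2 * b) := ⟨hb, by linarith⟩
  have hsub : Ioc 0 b ⊆ Ioo 0 (2 * b) := fun r hr => ⟨hr.1, by linarith [hr.2]⟩
  have hS : ∀ lam, SolvesSystem (radialP μ) (radialQ μ ν) lam (Ioo 0 (2 * b)) (w lam) (y lam) := hs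
  have hone : ∀ lam, Tendsto (w lam) (𝓝[>] 0) (𝓝 1) := fun lam => by
    obtain ⟨M, hM⟩ := hbd lam
    rw [tendsto_iff_norm_sub_tendsto_zero]
    have h0 : Tendsto (fun r : ℝ => M * |r - 0|) (𝓝[>] 0) (𝓝 0) := by
      have : Continuous fun r : ℝ => M * |r - 0| := by fun_prop
      simpa using (this.tendsto 0).mono_left nhdsWithin_le_nhds
    refine squeeze_zero' (Eventually.of_forall fun _ => norm_nonneg _) ?_ h0
    filter_upwards [Ioo_mem_nhdsGT (by positivity : (0 : ℝ) < 2 * b)] with r hr using (hM r hr).1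
  refine ⟨fun lam => w lam b, fun lam => y lam b, (hd b hbJ).1, (hd b hbJ).2, fun lam => ?_,
    fun lam z Y h hz hY hY0 hz0 => ?_⟩
  -- Zero data at `b` would propagate back to `w = 0` on `(0,b)`, against `w → 1` at `0`.
  · by_contra hcon
    push Not at hcon
    have hzero : ∀ᶠ r in 𝓝[>] (0 : ℝ), w lam r = 0 := by
      filter_upwards [Ioo_mem_nhdsGT hb] with r hr
      obtain ⟨w₁, y₁, w₂, y₂, -, -, -, -, hT⟩ := exists_entire_transfer μ hr.1 hr.2 hν hN
      have hsub' : Icc r b ⊆ Ioo 0 (2 * b) := fun s hs' => hsub ⟨hr.1.trans_le hs'.1, hs'.2⟩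
      have := (hT lam (w lam) (y lam) ((hS lam).mono (Ioo_subset_Icc_self.trans hsub'))
        ((hS lam).continuousOn.1.mono hsub') ((hS lam).continuousOn.2.mono hsub')).1
      simpa [hcon.1, hcon.2] using this
    exact one_ne_zero (tendsto_nhds_unique ((hone lam).congr' hzero) tendsto_const_nhds)
  · have hconst : ∀ r ∈ Ioo 0 b, z r * y lam r - Y r * w lam r =
        z b * y lam b - Y b * w lam b := fun r hr => by
      have h1 : Icc r b ⊆ Ioc 0 b := fun s hs' => ⟨hr.1.trans_le hs'.1, hs'.2⟩
      exact (h.mono fun s hs' => ⟨hr.1.trans hs'.1, hs'.2⟩).wronskian_eq hr.2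
        ((hS lam).mono (Ioo_subset_Icc_self.trans (h1.trans hsub))) (hz.mono h1) (hY.mono h1)
        ((hS lam).continuousOn.1.mono (h1.trans hsub))
        ((hS lam).continuousOn.2.mono (h1.trans hsub))
    -- `z y = (z r^{2μ+1}) (P y)`, where the first factor tends to `0` and `P y = O(r)`.
    have hzy : Tendsto (fun r => z r * y lam r) (𝓝[>] 0) (𝓝 0) := by
      obtain ⟨M, hM⟩ := hbd lam
      have h0 : Tendsto (fun r : ℝ => ‖z r * (r : ℂ) ^ (2 * μ + 1)‖ * (M * |r - 0|)) (𝓝[>] 0)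
          (𝓝 0) := by
        have : Continuous fun r : ℝ => M * |r - 0| := by fun_prop
        simpa using hz0.norm.mul ((this.tendsto 0).mono_left nhdsWithin_le_nhds)
      rw [tendsto_zero_iff_norm_tendsto_zero]
      refine squeeze_zero' (Eventually.of_forall fun _ => norm_nonneg _) ?_ h0
      filter_upwards [Ioo_mem_nhdsGT (by positivity : (0 : ℝ) < 2 * b)] with r hr
      have hr0 : (r : ℂ) ≠ 0 := by exact_mod_cast hr.1.ne'
      have h1 := (hM r hr).2.2
      rw [sub_zero] at h1
      have h2 : z r * y lam r = z r * (r : ℂ) ^ (2 * μ + 1) * (radialP μ r * y lam r) := by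
        rw [radialP]; field_simp
      rw [h2, norm_mul]
      exact mul_le_mul_of_nonneg_left h1 (norm_nonneg _)
    have hlim := hzy.sub (hY0.mul (hone lam))
    have hlim' := hlim.congr' (eventually_of_mem (Ioo_mem_nhdsGT hb) hconst)
    have := tendsto_nhds_unique hlim' tendsto_const_nhds
    simp only [zero_mul, sub_zero] at this
    exact sub_eq_zero.1 this.symm

/-- The first component `r^{-μ} f` of the first order system. -/
noncomputable def systemFst (μ : ℕ) (f : ℝ → ℂ) (r : ℝ) : ℂ := ((r : ℂ) ^ μ)⁻¹ * f r

/-- The second component `r^μ (r f' - μ f)` of the first order system. -/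
noncomputable def systemSnd (μ : ℕ) (a b : ℝ) (f : ℝ → ℂ) (r : ℝ) : ℂ :=
  (r : ℂ) ^ μ * ((r : ℂ) * derivWithin f (Icc a b) r - μ * f r)

lemma eq_pow_mul_systemFst (μ : ℕ) (f : ℝ → ℂ) {r : ℝ} (hr : 0 < r) :
    f r = (r : ℂ) ^ μ * systemFst μ f r := by
  have : (r : ℂ) ≠ 0 := by exact_mod_cast hr.ne'
  rw [systemFst]; field_simp

lemma derivWithin_eq_system (μ : ℕ) (a b : ℝ) (f : ℝ → ℂ) {r : ℝ} (hr : 0 < r) :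
    derivWithin f (Icc a b) r =
      ((r : ℂ) ^ (μ + 1))⁻¹ * systemSnd μ a b f r + μ / r * (r : ℂ) ^ μ * systemFst μ f r := by
  have : (r : ℂ) ≠ 0 := by exact_mod_cast hr.ne'
  rw [systemFst, systemSnd]; field_simp; ring

lemma hasDerivAt_ofReal_pow (μ : ℕ) {r : ℝ} (hr : 0 < r) :
    HasDerivAt (fun s : ℝ => (s : ℂ) ^ μ) (μ / r * (r : ℂ) ^ μ) r := by
  have h0 : (r : ℂ) ≠ 0 := by exact_mod_cast hr.ne'
  refine ((hasDerivAt_id (r : ℂ)).fun_pow μ).comp_ofReal.congr_deriv ?_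
  cases μ with
  | zero => simp
  | succ μ => simp only [id, Nat.add_sub_cancel, pow_succ]; field_simp

namespace SolvesRadial

variable {n : ℝ → ℝ} {m : ℤ} {k : ℂ} {a b : ℝ} {f : ℝ → ℂ}

lemma continuousOn_derivWithin (h : SolvesRadial n m k a b f) (hab : a < b) :
    ContinuousOn (derivWithin f (Icc a b)) (Icc a b) :=
  h.contDiff_one.continuousOn_derivWithin (uniqueDiffOn_Icc hab) le_rfl

lemma continuousOn_systemFst (h : SolvesRadial n m k a b f) (μ : ℕ) :
    ContinuousOn (systemFst μ f) (Icc a b ∩ Ioi 0) :=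
  ContinuousOn.mul (ContinuousOn.inv₀ (by fun_prop) fun r hr => by
    have : (r : ℂ) ≠ 0 := by exact_mod_cast hr.2.ne'
    positivity) (h.contDiff_one.continuousOn.mono inter_subset_left)

lemma continuousOn_systemSnd (h : SolvesRadial n m k a b f) (hab : a < b) (μ : ℕ) :
    ContinuousOn (systemSnd μ a b f) (Icc a b) := by
  have h1 := h.continuousOn_derivWithin hab
  have h2 := h.contDiff_one.continuousOn
  exact ContinuousOn.mul (by fun_prop)
    ((ContinuousOn.mul (by fun_prop) h1).sub (continuousOn_const.mul h2))

/-- The radial equation in first order form. -/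
lemma solvesSystem (h : SolvesRadial n m k a b f) (ha : 0 ≤ a) {ν : ℝ → ℝ}
    (hν : ∀ r ∈ Ioo a b, ν r = n r ^ 2) :
    SolvesSystem (radialP m.natAbs) (radialQ m.natAbs ν) (k ^ 2) (Ioo a b)
      (systemFst m.natAbs f) (systemSnd m.natAbs a b f) := by
  intro r hr
  set μ := m.natAbs with hμ
  have hr0 : 0 < r := ha.trans_lt hr.1
  have hrc : (r : ℂ) ≠ 0 := by exact_mod_cast hr0.ne'
  have hm : (m : ℂ) ^ 2 = (μ : ℂ) ^ 2 := by
    have : ((m.natAbs : ℤ) : ℂ) ^ 2 = (m : ℂ) ^ 2 := by exact_mod_cast m.natAbs_sq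
    rw [← this, hμ]; simp
  have hdw : ∀ s ∈ Ioo a b, derivWithin f (Icc a b) s = deriv f s := fun s hs =>
    derivWithin_of_mem_nhds (Icc_mem_nhds hs.1 hs.2)
  have hf : HasDerivAt f (deriv f r) r :=
    ((h.contDiff_two.contDiffAt (isOpen_Ioo.mem_nhds hr)).differentiableAt (by simp)).hasDerivAt
  have hf2 : DifferentiableAt ℝ (deriv f) r :=
    ((h.contDiff_two.deriv_of_isOpen (m := 1) isOpen_Ioo (by norm_num)).contDiffAt
      (isOpen_Ioo.mem_nhds hr)).differentiableAt (by simp)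
  have hrf : HasDerivAt (fun s : ℝ => (s : ℂ) * deriv f s)
      (r * ((μ : ℂ) ^ 2 / (r : ℂ) ^ 2 - (k * (n r : ℂ)) ^ 2) * f r) r := by
    have hd : DifferentiableAt ℝ (fun s : ℝ => (s : ℂ) * deriv f s) r :=
      Complex.ofRealCLM.differentiableAt.fun_mul hf2
    refine hd.hasDerivAt.congr_deriv ?_
    have he := h.eq_zero r hr
    rw [radialOp, hm] at he
    field_simp at he ⊢
    linear_combination -he
  have hpow := hasDerivAt_ofReal_pow μ hr0
  constructor
  · refine ((hpow.fun_inv (by positivity)).fun_mul hf).congr_deriv ?_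
    rw [radialP, systemSnd, hdw r hr]
    field_simp
    ring
  -- The `μ f'` and `μ²` terms cancel, leaving `-k² r^{μ+1} n² f = -k² r^{2μ+1} n² z`.
  · have hY := hpow.fun_mul (hrf.fun_sub (hf.const_mul (μ : ℂ)))
    refine (hY.congr_of_eventuallyEq (f₁ := systemSnd μ a b f)
      (eventually_of_mem (isOpen_Ioo.mem_nhds hr) fun s hs => ?_)).congr_deriv ?_
    · simp only [systemSnd, hdw s hs]
    · rw [radialQ, systemFst, hν r hr]
      push_cast
      field_simp
      ring

lemma tendsto_systemSnd_zero (h : SolvesRadial n m k 0 b f) (hb : 0 < b) (μ : ℕ) :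
    Tendsto (systemSnd μ 0 b f) (𝓝[>] 0) (𝓝 0) := by
  have h1 := (h.continuousOn_systemSnd hb μ) 0 ⟨le_rfl, hb.le⟩
  -- For `μ = 0` the prefactor is `1` even at `0`; the value vanishes because both `r f'` and `μ f`
  -- do.
  have h0 : systemSnd μ 0 b f 0 = 0 := by
    cases μ <;> simp [systemSnd]
  have h2 : Tendsto (systemSnd μ 0 b f) (𝓝[Icc 0 b] 0) (𝓝 0) := by
    simpa only [h0] using h1.tendsto
  exact h2.mono_left (nhdsWithin_le_of_mem (mem_of_superset (Ioo_mem_nhdsGT hb)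
    Ioo_subset_Icc_self))

lemma tendsto_systemFst_mul_zero (h : SolvesRadial n m k 0 b f) (hb : 0 < b) (μ : ℕ) :
    Tendsto (fun r : ℝ => systemFst μ f r * (r : ℂ) ^ (2 * μ + 1)) (𝓝[>] 0) (𝓝 0) := by
  have h1 : ContinuousOn (fun r : ℝ => (r : ℂ) ^ (μ + 1) * f r) (Icc 0 b) :=
    ContinuousOn.mul (by fun_prop) h.contDiff_one.continuousOn
  have h2 : Tendsto (fun r : ℝ => (r : ℂ) ^ (μ + 1) * f r) (𝓝[Icc 0 b] 0) (𝓝 0) := by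
    simpa using (h1 0 ⟨le_rfl, hb.le⟩).tendsto
  refine (h2.mono_left (nhdsWithin_le_of_mem (mem_of_superset (Ioo_mem_nhdsGT hb)
    Ioo_subset_Icc_self))).congr' ?_
  filter_upwards [self_mem_nhdsWithin] with r hr
  have : (r : ℂ) ≠ 0 := by exact_mod_cast (ne_of_gt hr)
  rw [systemFst]
  field_simp
  ring

end SolvesRadial

/-! ### Analyticity of the Cauchy data in the wave number -/

/-- The Cauchy data at `ξ` of the solutions of the inner problem are holomorphic in `k`. -/
theorem differentiableOn_inner {ξ : ℝ} (hξ : 0 < ξ) {n ν : ℝ → ℝ} {N n₁ξ : ℝ}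
    (hν : ContinuousOn ν (Ioi 0)) (hN : ∀ r > 0, |ν r| ≤ N)
    (hνn : ∀ r ∈ Ioo 0 ξ, ν r = n r ^ 2) {m : ℤ} {U : Set ℂ} {h : ℂ → ℂ}
    (hh : DifferentiableOn ℂ h U) (hh0 : ∀ k ∈ U, h k ≠ 0) {f : ℂ → ℝ → ℂ}
    (hf : ∀ k ∈ U, SolvesInner ξ n n₁ξ m k (h k) (f k)) :
    DifferentiableOn ℂ (fun k => f k ξ) U ∧
      DifferentiableOn ℂ (fun k => derivWithin (f k) (Icc 0 ξ) ξ) U := by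
  set μ := m.natAbs
  obtain ⟨w, y, hw, hy, hne, hreg⟩ := exists_entire_regular_data μ hξ hν hN
  set α : ℂ := ((ξ : ℂ) ^ (μ + 1))⁻¹
  set γ : ℂ := (ξ : ℂ) ^ μ
  set β : ℂ → ℂ := fun k => (μ / ξ - Complex.I * k * n₁ξ) * γ
  -- The Robin functional at `ξ` applied to the entire regular data, so `z = c w`, `Y = c y` gives
  -- `c D = h`.
  set D : ℂ → ℂ := fun k => α * y (k ^ 2) + β k * w (k ^ 2)
  have hw2 : Differentiable ℂ fun k : ℂ => w (k ^ 2) := hw.comp (by fun_prop)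
  have hy2 : Differentiable ℂ fun k : ℂ => y (k ^ 2) := hy.comp (by fun_prop)
  have hβ : Differentiable ℂ β := by fun_prop
  have hDd : Differentiable ℂ D := (hy2.const_mul α).add (hβ.mul hw2)
  have key : ∀ k ∈ U, D k ≠ 0 ∧ systemFst μ (f k) ξ = h k * w (k ^ 2) / D k ∧
      systemSnd μ 0 ξ (f k) ξ = h k * y (k ^ 2) / D k := fun k hk => by
    have hs := (hf k hk).solves
    have hprop := hreg (k ^ 2) _ _ (hs.solvesSystem le_rfl hνn)
      ((hs.continuousOn_systemFst μ).mono fun r hr => ⟨⟨hr.1.le, hr.2⟩, hr.1⟩)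
      ((hs.continuousOn_systemSnd hξ μ).mono Ioc_subset_Icc_self)
      (hs.tendsto_systemSnd_zero hξ μ) (hs.tendsto_systemFst_mul_zero hξ μ)
    have hrob := (hf k hk).robin
    rw [derivWithin_eq_system μ 0 ξ (f k) hξ, eq_pow_mul_systemFst μ (f k) hξ] at hrob
    set z := systemFst μ (f k) ξ
    set Y := systemSnd μ 0 ξ (f k) ξ
    have e1 : z * D k = h k * w (k ^ 2) := by
      simp only [D, β]
      linear_combination α * hprop + w (k ^ 2) * hrob
    have e2 : Y * D k = h k * y (k ^ 2) := by
      simp only [D, β]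
      linear_combination
        -(μ / ξ - Complex.I * k * n₁ξ) * γ * hprop + y (k ^ 2) * hrob
    -- If `D k = 0`, then `h w = h y = 0`, impossible for a nonzero vector and `h ≠ 0`.
    have hD0 : D k ≠ 0 := fun h0 => by
      rw [h0, mul_zero, eq_comm, mul_eq_zero] at e1 e2
      rcases hne (k ^ 2) with hc | hc
      · exact hc (e1.resolve_left (hh0 k hk))
      · exact hc (e2.resolve_left (hh0 k hk))
    exact ⟨hD0, by rw [eq_div_iff hD0, e1], by rw [eq_div_iff hD0, e2]⟩
  have hz : DifferentiableOn ℂ (fun k => systemFst μ (f k) ξ) U :=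
    ((hh.fun_mul hw2.differentiableOn).fun_div hDd.differentiableOn fun k hk => (key k hk).1).congr
      fun k hk => (key k hk).2.1
  have hY : DifferentiableOn ℂ (fun k => systemSnd μ 0 ξ (f k) ξ) U :=
    ((hh.fun_mul hy2.differentiableOn).fun_div hDd.differentiableOn fun k hk => (key k hk).1).congr
      fun k hk => (key k hk).2.2
  exact ⟨(hz.const_mul γ).congr fun k _ => eq_pow_mul_systemFst μ (f k) hξ,
    ((hY.const_mul α).fun_add (hz.const_mul (μ / ξ * γ))).congr
      fun k _ => derivWithin_eq_system μ 0 ξ (f k) hξ⟩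

/-- The Cauchy data at `ξ` of the solutions of the outer problem are holomorphic in `k`. -/
theorem differentiableOn_outer {ξ : ℝ} (hξ : ξ ∈ Ioo (0 : ℝ) 1) {n ν : ℝ → ℝ} {N n₂ξ n₂one : ℝ}
    (hν : ContinuousOn ν (Ioi 0)) (hN : ∀ r > 0, |ν r| ≤ N)
    (hνn : ∀ r ∈ Ioo ξ 1, ν r = n r ^ 2) {m : ℤ} {U : Set ℂ} {h : ℂ → ℂ}
    (hdtn : DifferentiableOn ℂ (fun k => dtnSymbol m (k * n₂one)) U)
    (hh : DifferentiableOn ℂ h U) (hh0 : ∀ k ∈ U, h k ≠ 0) {f : ℂ → ℝ → ℂ}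
    (hf : ∀ k ∈ U, SolvesOuter ξ n n₂ξ n₂one m k (h k) (f k)) :
    DifferentiableOn ℂ (fun k => f k ξ) U ∧
      DifferentiableOn ℂ (fun k => derivWithin (f k) (Icc ξ 1) ξ) U := by
  set μ := m.natAbs
  obtain ⟨w₁, y₁, w₂, y₂, hw₁, hy₁, hw₂, hy₂, hT⟩ :=
    exists_entire_transfer μ hξ.1 hξ.2 hν hN
  set α : ℂ := ((ξ : ℂ) ^ (μ + 1))⁻¹
  set γ : ℂ := (ξ : ℂ) ^ μ
  -- At `r = 1` the system variables are `z = f(1)` and `Y = f'(1) - μ f(1)`, so the boundary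
  -- condition reads `Y = β z`.
  set β : ℂ → ℂ := fun k => dtnSymbol m (k * n₂one) - μ
  set A : ℂ → ℂ := fun k => w₁ (k ^ 2) + w₂ (k ^ 2) * β k
  set B : ℂ → ℂ := fun k => y₁ (k ^ 2) + y₂ (k ^ 2) * β k
  set E : ℂ → ℂ := fun k =>
    -(α * B k) - μ / ξ * γ * A k - Complex.I * k * n₂ξ * γ * A k
  have hβ : DifferentiableOn ℂ β U := hdtn.sub_const _
  have hsq : ∀ {g : ℂ → ℂ}, Differentiable ℂ g → DifferentiableOn ℂ (fun k : ℂ => g (k ^ 2)) U :=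
    fun hg => (hg.comp (by fun_prop : Differentiable ℂ fun k : ℂ => k ^ 2)).differentiableOn
  have hA : DifferentiableOn ℂ A U := (hsq hw₁).fun_add ((hsq hw₂).fun_mul hβ)
  have hB : DifferentiableOn ℂ B U := (hsq hy₁).fun_add ((hsq hy₂).fun_mul hβ)
  have hE : DifferentiableOn ℂ E U := by
    refine ((hB.const_mul α).fun_neg.fun_sub (hA.const_mul _)).fun_sub (DifferentiableOn.fun_mul ?_ hA)
    exact Differentiable.differentiableOn (by fun_prop)
  have key : ∀ k ∈ U, E k ≠ 0 ∧ systemFst μ (f k) ξ = h k / E k * A k ∧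
      systemSnd μ ξ 1 (f k) ξ = h k / E k * B k := fun k hk => by
    have hs := (hf k hk).solves
    obtain ⟨e1, e2⟩ := hT (k ^ 2) _ _ (hs.solvesSystem hξ.1.le hνn)
      ((hs.continuousOn_systemFst μ).mono fun r hr => ⟨hr, hξ.1.trans_le hr.1⟩)
      (hs.continuousOn_systemSnd hξ.2 μ)
    have hz1 : systemFst μ (f k) 1 = f k 1 := by simp [systemFst]
    have hY1 : systemSnd μ ξ 1 (f k) 1 = β k * f k 1 := by
      simp only [systemSnd, β, Complex.ofReal_one, one_pow, one_mul]
      linear_combination (hf k hk).dtn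
    rw [hz1, hY1] at e1 e2
    have hrob := (hf k hk).robin
    rw [derivWithin_eq_system μ ξ 1 (f k) hξ.1, eq_pow_mul_systemFst μ (f k) hξ.1, e1, e2] at hrob
    -- All data are multiples of `f(1)`, so the Robin condition at `ξ` becomes this scalar equation;
    -- `h ≠ 0` then excludes `E = 0`.
    have hfE : f k 1 * E k = h k := by
      simp only [E, A, B]
      linear_combination hrob
    have hE0 : E k ≠ 0 := fun h0 => hh0 k hk (by rw [← hfE, h0, mul_zero])
    rw [e1, e2, ← hfE, mul_div_cancel_right₀ _ hE0]
    exact ⟨hE0, by simp only [A]; ring, by simp only [B]; ring⟩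
  have hq : DifferentiableOn ℂ (fun k => h k / E k) U := hh.fun_div hE fun k hk => (key k hk).1
  have hz : DifferentiableOn ℂ (fun k => systemFst μ (f k) ξ) U :=
    (hq.fun_mul hA).congr fun k hk => (key k hk).2.1
  have hY : DifferentiableOn ℂ (fun k => systemSnd μ ξ 1 (f k) ξ) U :=
    (hq.fun_mul hB).congr fun k hk => (key k hk).2.2
  exact ⟨(hz.const_mul γ).congr fun k _ => eq_pow_mul_systemFst μ (f k) hξ.1,
    ((hY.const_mul α).fun_add (hz.const_mul (μ / ξ * γ))).congr
      fun k _ => derivWithin_eq_system μ ξ 1 (f k) hξ.1⟩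

/-! ### Continuous extension of the refractive index -/

/-- The value of `g₁` at `p` is never taken, so a left limit suffices for gluing. -/
lemma continuousAt_ite_lt {g₁ g₂ : ℝ → ℝ} {p r : ℝ}
    (h₁ : r < p → ContinuousAt g₁ r) (h₂ : p < r → ContinuousAt g₂ r)
    (hl : r = p → Tendsto g₁ (𝓝[<] p) (𝓝 (g₂ p))) (hr : r = p → ContinuousAt g₂ p) :
    ContinuousAt (fun s => if s < p then g₁ s else g₂ s) r := by
  rcases lt_trichotomy r p with h | h | h
  · exact (h₁ h).congr (eventually_of_mem (Iio_mem_nhds h) fun s hs => (if_pos hs).symm)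
  · subst h
    rw [continuousAt_iff_continuous_left'_right']
    constructor
    · have h3 : Tendsto g₁ (𝓝[<] r) (𝓝 (if r < r then g₁ r else g₂ r)) := by simpa using hl rfl
      exact h3.congr' (eventually_of_mem self_mem_nhdsWithin fun s hs => (if_pos hs).symm)
    · have h3 : Tendsto g₂ (𝓝[>] r) (𝓝 (if r < r then g₁ r else g₂ r)) := by
        simpa using (hr rfl).tendsto.mono_left nhdsWithin_le_nhds
      exact h3.congr' (eventually_of_mem self_mem_nhdsWithin fun s hs =>
        (if_neg (not_lt.2 (le_of_lt hs))).symm)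
  · exact (h₂ h).congr (eventually_of_mem (Ioi_mem_nhds h) fun s hs =>
      (if_neg (not_lt.2 (le_of_lt hs))).symm)

namespace IsRefractiveIndex

variable {ξ : ℝ} {n : ℝ → ℝ} {n₁ξ n₂ξ n₂one : ℝ}

lemma pos_one (hn : IsRefractiveIndex ξ n n₁ξ n₂ξ n₂one) : 0 < n₂one := by
  obtain ⟨nmin, nmax, h0, hb⟩ := hn.bounded
  refine h0.trans_le (ge_of_tendsto hn.tendsto_one ?_)
  filter_upwards [Ioo_mem_nhdsLT (zero_lt_one' ℝ)] with r hr using (hb r hr).1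

lemma exists_abs_sq_le (hn : IsRefractiveIndex ξ n n₁ξ n₂ξ n₂one) :
    ∃ N, ∀ r ∈ Ioo (0 : ℝ) 1, |n r ^ 2| ≤ N := by
  obtain ⟨nmin, nmax, h0, hb⟩ := hn.bounded
  refine ⟨nmax ^ 2, fun r hr => ?_⟩
  rw [abs_of_nonneg (sq_nonneg _)]
  have := hb r hr
  exact pow_le_pow_left₀ (h0.le.trans this.1) this.2 2

/-- The Volterra kernels live on intervals reaching past the end points of the problem, so `n²` is
continued by its boundary value. -/
lemma exists_extension_inner (hn : IsRefractiveIndex ξ n n₁ξ n₂ξ n₂one) :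
    ∃ (ν : ℝ → ℝ) (N : ℝ), ContinuousOn ν (Ioi 0) ∧ (∀ r > 0, |ν r| ≤ N) ∧
      ∀ r ∈ Ioo 0 ξ, ν r = n r ^ 2 := by
  obtain ⟨N, hN⟩ := hn.exists_abs_sq_le
  refine ⟨fun r => if r < ξ then n r ^ 2 else n₁ξ ^ 2, max N |n₁ξ ^ 2|, fun r hr => ?_,
    fun r hr => ?_, fun r hr => if_pos hr.2⟩
  · refine (continuousAt_ite_lt (g₂ := fun _ => n₁ξ ^ 2) (fun h => ?_)
      (fun _ => continuousAt_const) (fun _ => hn.tendsto_left.pow 2)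
      fun _ => continuousAt_const).continuousWithinAt
    exact (hn.smooth_left.continuousOn.continuousAt (Ioo_mem_nhds hr h)).pow 2
  · dsimp only
    split_ifs with h
    · exact (hN r ⟨hr, h.trans hn.jump_mem.2⟩).trans (le_max_left _ _)
    · exact le_max_right _ _

/-- Both sides need continuation here: the transfer kernel from `1` to `ξ` lives on `(ξ/2, 2)`. -/
lemma exists_extension_outer (hn : IsRefractiveIndex ξ n n₁ξ n₂ξ n₂one) :
    ∃ (ν : ℝ → ℝ) (N : ℝ), ContinuousOn ν (Ioi 0) ∧ (∀ r > 0, |ν r| ≤ N) ∧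
      ∀ r ∈ Ioo ξ 1, ν r = n r ^ 2 := by
  obtain ⟨N, hN⟩ := hn.exists_abs_sq_le
  have hξ := hn.jump_mem
  refine ⟨fun r => if r < 1 then (if ξ < r then n r ^ 2 else n₂ξ ^ 2) else n₂one ^ 2,
    max N (max |n₂ξ ^ 2| |n₂one ^ 2|), fun r hr => ?_, fun r hr => ?_, fun r hr => ?_⟩
  · refine (continuousAt_ite_lt (g₁ := fun r => if ξ < r then n r ^ 2 else n₂ξ ^ 2)
      (g₂ := fun _ => n₂one ^ 2) (fun h => ?_)
      (fun _ => continuousAt_const) (fun _ => ?_) fun _ => continuousAt_const).continuousWithinAt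
    · rcases lt_trichotomy r ξ with h' | h' | h'
      · exact continuousAt_const.congr (eventually_of_mem (Iio_mem_nhds h') fun s hs =>
          (if_neg (not_lt.2 (le_of_lt hs))).symm)
      · subst h'
        rw [continuousAt_iff_continuous_left'_right']
        constructor
        · have h3 : Tendsto (fun _ : ℝ => n₂ξ ^ 2) (𝓝[<] r)
              (𝓝 (if r < r then n r ^ 2 else n₂ξ ^ 2)) := by simp
          exact h3.congr' (eventually_of_mem self_mem_nhdsWithin fun s hs =>
            (if_neg (not_lt.2 (le_of_lt hs))).symm)
        · have h3 : Tendsto (fun r => n r ^ 2) (𝓝[>] r)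
              (𝓝 (if r < r then n r ^ 2 else n₂ξ ^ 2)) := by simpa using hn.tendsto_right.pow 2
          exact h3.congr' (eventually_of_mem self_mem_nhdsWithin fun s hs => (if_pos hs).symm)
      · exact ((hn.smooth_right.continuousOn.continuousAt (Ioo_mem_nhds h' h)).pow 2).congr
          (eventually_of_mem (Ioi_mem_nhds h') fun s hs => (if_pos hs).symm)
    · exact (hn.tendsto_one.pow 2).congr' (eventually_of_mem (Ioo_mem_nhdsLT hξ.2) fun s hs =>
        (if_pos hs.1).symm)
  · dsimp only
    split_ifs with h h'
    · exact (hN r ⟨hr, h⟩).trans (le_max_left _ _)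
    · exact (le_max_left _ _).trans (le_max_right _ _)
    · exact (le_max_right _ _).trans (le_max_right _ _)
  · simp only [if_pos hr.2, if_pos hr.1]

end IsRefractiveIndex

/-- `det` is holomorphic. -/
theorem differentiableOn_detT {ξ : ℝ} {n : ℝ → ℝ} {n₁ξ n₂ξ n₂one : ℝ}
    (hn : IsRefractiveIndex ξ n n₁ξ n₂ξ n₂one) {m : ℤ} {U : Set ℂ} (hU : ∀ k ∈ U, k.im < 0)
    (hH : ∀ k ∈ U, hankelH m (k * n₂one) ≠ 0) {h₁ h₂ : ℂ → ℂ}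
    (hh₁ : DifferentiableOn ℂ h₁ U) (hh₂ : DifferentiableOn ℂ h₂ U)
    (hh₁_ne : ∀ k ∈ U, h₁ k ≠ 0) (hh₂_ne : ∀ k ∈ U, h₂ k ≠ 0) {f₁ f₂ : ℂ → ℝ → ℂ}
    (hf₁ : ∀ k ∈ U, SolvesInner ξ n n₁ξ m k (h₁ k) (f₁ k))
    (hf₂ : ∀ k ∈ U, SolvesOuter ξ n n₂ξ n₂one m k (h₂ k) (f₂ k)) :
    DifferentiableOn ℂ (detT ξ f₁ f₂) U := by
  obtain ⟨ν₁, N₁, c₁, b₁, e₁⟩ := hn.exists_extension_inner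
  obtain ⟨ν₂, N₂, c₂, b₂, e₂⟩ := hn.exists_extension_outer
  obtain ⟨d₁, d₁'⟩ := differentiableOn_inner hn.jump_mem.1 c₁ b₁ e₁ hh₁ hh₁_ne hf₁
  obtain ⟨d₂, d₂'⟩ := differentiableOn_outer hn.jump_mem c₂ b₂ e₂
    (differentiableOn_dtnSymbol m hn.pos_one hU hH) hh₂ hh₂_ne hf₂
  refine ((d₁.fun_mul d₂'.fun_neg).fun_sub (d₂.fun_neg.fun_mul d₁')).congr fun k _ => ?_
  simp [detT, transmissionMatrix, Matrix.det_fin_two_of]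

end RadialHelmholtz

theorem theorem3p2
    (ξ : ℝ) (n : ℝ → ℝ) (n₁ξ n₂ξ n₂one : ℝ)
    (hn : IsRefractiveIndex ξ n n₁ξ n₂ξ n₂one)
    (m : ℤ) (kinf : ℂ) (hkinf : kinf.im < 0) (hres : IsResonance n n₂one kinf)
    (U : Set ℂ) (hUopen : IsOpen U) (hUmem : kinf ∈ U) (hUsub : ∀ k ∈ U, k.im < 0)
    (h₁ h₂ : ℂ → ℂ)
    (hh₁ : AnalyticOnNhd ℂ h₁ U) (hh₂ : AnalyticOnNhd ℂ h₂ U)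
    (hh₁_ne : ∀ k ∈ U, h₁ k ≠ 0) (hh₂_ne : ∀ k ∈ U, h₂ k ≠ 0)
    (hwp : WellPosedOn ξ n n₁ξ n₂ξ n₂one m h₁ h₂ U)
    (f₁ f₂ : ℂ → ℝ → ℂ)
    (hf₁ : ∀ k ∈ U, SolvesInner ξ n n₁ξ m k (h₁ k) (f₁ k))
    (hf₂ : ∀ k ∈ U, SolvesOuter ξ n n₂ξ n₂one m k (h₂ k) (f₂ k)) :
    AnalyticOnNhd ℂ (detT ξ f₁ f₂) U ∧
    (detT ξ f₁ f₂ kinf = 0 → deriv (detT ξ f₁ f₂) kinf ≠ 0 →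
      ∃ δ > 0, ∃ C : ℝ, Metric.ball kinf δ ⊆ U ∧
        ∀ κ : ℕ → ℂ, κ 0 ∈ Metric.ball kinf δ →
          (∀ l, κ (l + 1) = κ l - detT ξ f₁ f₂ (κ l) / deriv (detT ξ f₁ f₂) (κ l)) →
          (∀ l, κ l ∈ Metric.ball kinf δ ∧ deriv (detT ξ f₁ f₂) (κ l) ≠ 0) ∧
          Tendsto κ atTop (𝓝 kinf) ∧
          ∀ l, ‖κ (l + 1) - kinf‖ ≤ C * ‖κ l - kinf‖ ^ 2) := by
  have hdet := differentiableOn_detT hn hUsub hwp.hankel_ne_zero hh₁.differentiableOn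
    hh₂.differentiableOn hh₁_ne hh₂_ne hf₁ hf₂
  exact ⟨hdet.analyticOnNhd hUopen, newton_quadratic_convergence hUopen hUmem hdet⟩
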